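/- Let $T\ge 1$ be an integer, let $p_l>0$ $(l\in\mathbb N)$ satisfy $\sum_{l=1}^\infty p_l=1$, let $\theta_l\in\mathbb C$ $(l\in\mathbb N)$ satisfy $\sup_l|\theta_l|<\infty$, and let $b_1\in\mathbb C$. Let $\mathcal T$ be the rooted tree with $T$ tiers of edges, each parametrized by $t\in[0,1]$ directed away from the root, in which exactly one edge $e_1$ starts at the root and countably many edges $e_{\nu_{j,l}}$, $l\in\mathbb N$, start at the end of each edge $e_j$ of a tier $k<T$; the ends of these edges $e_j$ are the internal vertices. Put $V_j=\{\nu_{j,l}:l\in\mathbb N\}$ and $$b_{\nu_{j,l}}=\theta_l,\qquad \tilde p_{\nu_{j,l}}=p_l,\qquad \alpha_1=1,\qquad \alpha_{\nu}=\tilde p_{\nu}\,\alpha_j\quad(\nu\in V_j).$$ Let $W^s_{2,\alpha}$ be the Hilbert space of the tuples $y=[y_j]$, indexed by the edges, with $y_j\in W_2^s[0,1]$ and $\sum_j\alpha_j\|y_j\|^2_{W_2^s[0,1]}<\infty$, with the inner product $\langle y,z\rangle_s=\sum_j\alpha_j\langle y_j,z_j\rangle_{W_2^s[0,1]}$, and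 let $L_{2,\alpha}=W^0_{2,\alpha}$. Let $\mathcal L$ be the operator in $L_{2,\alpha}$ given by $$\mathcal L y=[\mathcal L_jy_j],\qquad \mathcal L_jy_j=-y_j''-2i(\operatorname{Im} b_j)y_j'+|b_j|^2y_j,$$ whose domain consists of all $y=[y_j]\in W^2_{2,\alpha}$ such that - $y_j(1)=y_\nu(0)$ for every edge $e_j$ that ends in an internal vertex and every $\nu\in V_j$; - $y_j'(1)+\beta_jy_j(1)=\sum_{\nu\in V_j}\tilde p_\nu y_\nu'(0)$, where $\beta_j=b_j-\sum_{\nu\in V_j}\tilde p_\nu b_\nu$, for every edge $e_j$ that ends in an internal vertex; - $y_1(0)=0$; - $y_j(1)=0$ for every edge $e_j$ of the last tier $T$. Then $\mathcal L$ is densely defined, self-adjoint and positive definite: $\mathcal L^*=\mathcal L$, and there is $c>0$ with $\langle\mathcal Ly,y\rangle_0\ge c\|y\|_0^2$ for all $y$ in the domain of $\mathcal L$. -/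

import Mathlib

open MeasureTheory

noncomputable section

/-- The data of the controlled process: the number `T ≥ 1` of tiers of the tree, the probabilities
`p l > 0` with sum `1`, the bounded complex values `θ l` which the coefficient takes with
probability `p l` at each of the times `1, …, T - 1`, and the value `b₁` of the coefficient on the
first edge. -/
structure TimeTree where
  T : ℕ
  T_pos : 0 < T
  p : ℕ → ℝ
  p_pos : ∀ l, 0 < p l
  p_sum : HasSum p 1
  θ : ℕ → ℂ
  θ_bdd : ∃ M : ℝ, ∀ l, ‖θ l‖ ≤ M
  b₁ : ℂ

namespace TimeTree

/-- The edges of the tree. An edge of tier `k` is given by the list of the `k - 1` choices made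
along the path from the root, the most recent choice first. -/
abbrev Edge (P : TimeTree) : Type := {w : List ℕ // w.length < P.T}

variable (P : TimeTree)

/-- The first edge, which starts at the root of the tree. -/
def root : P.Edge := ⟨[], P.T_pos⟩

/-- The end of the edge `e` is an internal vertex. -/
def IsInner (e : P.Edge) : Prop := e.1.length + 1 < P.T

/-- The end of the edge `e` is a boundary vertex. -/
def IsLeaf (e : P.Edge) : Prop := e.1.length + 1 = P.T

/-- The `l`-th edge that starts at the (internal) end of the edge `e`. -/
def child (e : P.Edge) (he : P.IsInner e) (l : ℕ) : P.Edge := ⟨l :: e.1, he⟩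

/-- The coefficient: `b₁` on the first edge, `θ l` on the `l`-th edge that leaves a vertex. -/
def coeff (e : P.Edge) : ℂ :=
  match e.1 with
  | [] => P.b₁
  | l :: _ => P.θ l

/-- The probability of an edge: the product of the `p l` over the choices `l` on its path. -/
def weight (e : P.Edge) : ℝ := (e.1.map P.p).prod

/-- The measure `α dt` on `[0, 1]`, where `α` is the weight of the edge. -/
def edgeMeasure (e : P.Edge) : Measure ℝ :=
  ENNReal.ofReal (P.weight e) • volume.restrict (Set.Icc 0 1)

/-- The Hilbert space `L_{2,α}` of tuples `[y_e]` with
`‖y‖² = ∑ₑ αₑ ∫₀¹ |y_e(t)|² dt < ∞`, as a Hilbert sum. -/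
abbrev L2α : Type := lp (fun e : P.Edge => Lp ℂ 2 (P.edgeMeasure e)) 2

/-- `f` belongs to `W_2^1[0,1]` and `f' = g`: the function `f` is absolutely continuous on `[0, 1]`
(an indefinite integral), with derivative `g` in `L_2(0,1)`. -/
structure IsW21 (f g : ℝ → ℂ) : Prop where
  memLp : MemLp g 2 (volume.restrict (Set.Icc (0 : ℝ) 1))
  eq : ∀ t ∈ Set.Icc (0 : ℝ) 1, f t = f 0 + ∫ s in (0 : ℝ)..t, g s

/-- The tuple `y` belongs to `W^2_{2,α}`, with first derivatives `y1` and second derivatives `y2`: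
every `y_e` is in `W_2^2[0,1]`, and `∑ₑ αₑ ‖y_e‖²_{W_2^2[0,1]} < ∞`. -/
structure IsW22α (y y1 y2 : P.Edge → ℝ → ℂ) : Prop where
  first : ∀ e, IsW21 (y e) (y1 e)
  second : ∀ e, IsW21 (y1 e) (y2 e)
  summable : Summable fun e => P.weight e *
    ((∫ t in Set.Icc (0 : ℝ) 1, ‖y e t‖ ^ 2) + (∫ t in Set.Icc (0 : ℝ) 1, ‖y1 e t‖ ^ 2)
      + ∫ t in Set.Icc (0 : ℝ) 1, ‖y2 e t‖ ^ 2)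

/-- The coefficient `β` in the Kirchhoff condition at the end of the edge `e`. -/
def kirchhoffCoeff (e : P.Edge) : ℂ := P.coeff e - ∑' l, (P.p l : ℂ) * P.θ l

/-- The tuple `y` is in `W^2_{2,α}` (with derivatives `y1`, `y2`) and satisfies the gluing and
Kirchhoff conditions, the zero initial condition and the zero terminal conditions. -/
structure IsAdmissible (y y1 y2 : P.Edge → ℝ → ℂ) : Prop extends P.IsW22α y y1 y2 where
  gluing : ∀ (e : P.Edge) (he : P.IsInner e) (l : ℕ), y e 1 = y (P.child e he l) 0
  kirchhoff : ∀ (e : P.Edge) (he : P.IsInner e),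
    HasSum (fun l => (P.p l : ℂ) * y1 (P.child e he l) 0)
      (y1 e 1 + P.kirchhoffCoeff e * y e 1)
  initial : y P.root 0 = 0
  terminal : ∀ e : P.Edge, P.IsLeaf e → y e 1 = 0

/-- The differential expression `-y'' - 2i (Im b) y' + |b|² y`. -/
def diffExpr (b : ℂ) (y y1 y2 : ℝ → ℂ) (t : ℝ) : ℂ :=
  -y2 t - 2 * Complex.I * (b.im : ℂ) * y1 t + ((‖b‖ ^ 2 : ℝ) : ℂ) * y t

/-- The element `f` of `L_{2,α}` is the class of the tuple of functions `y`. -/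
def Represents (f : P.L2α) (y : P.Edge → ℝ → ℂ) : Prop :=
  ∀ e, (f e : ℝ → ℂ) =ᵐ[P.edgeMeasure e] y e

/-- `f` is an admissible tuple and `h` is the tuple of the values of the differential expressions
on it. -/
def Rel (f h : P.L2α) : Prop :=
  ∃ y y1 y2, P.IsAdmissible y y1 y2 ∧ P.Represents f y ∧
    P.Represents h fun e => diffExpr (P.coeff e) (y e) (y1 e) (y2 e)

variable {P}

/-! Helper facts: the conditions are linear, the differential expressions map admissible tuples to
`L_{2,α}`, and their values depend only on the class of the tuple. -/

theorem weight_pos (e : P.Edge) : 0 < P.weight e := by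
  unfold weight
  apply List.prod_pos
  intro a ha
  obtain ⟨l, -, rfl⟩ := List.mem_map.1 ha
  exact P.p_pos l

theorem edgeMeasure_ae (e : P.Edge) :
    ae (P.edgeMeasure e) = ae (volume.restrict (Set.Icc (0 : ℝ) 1)) := by
  unfold edgeMeasure
  apply Measure.ae_ennreal_smul_measure_eq
  simpa using weight_pos e

theorem IsW21.intervalIntegrable {f g : ℝ → ℂ} (h : IsW21 f g) {t : ℝ}
    (ht : t ∈ Set.Icc (0 : ℝ) 1) : IntervalIntegrable g volume 0 t := by
  rw [intervalIntegrable_iff_integrableOn_Icc_of_le ht.1]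
  have : IntegrableOn g (Set.Icc 0 1) := h.memLp.integrable (by norm_num)
  exact this.mono_set (Set.Icc_subset_Icc_right ht.2)

theorem IsW21.continuousOn {f g : ℝ → ℂ} (h : IsW21 f g) : ContinuousOn f (Set.Icc 0 1) := by
  have h1 : IntegrableOn g (Set.uIcc 0 1) := by
    rw [Set.uIcc_of_le zero_le_one]
    exact h.memLp.integrable (by norm_num)
  have h2 := intervalIntegral.continuousOn_primitive_interval h1
  rw [Set.uIcc_of_le zero_le_one] at h2
  exact (continuousOn_const.add h2).congr h.eq

theorem IsW21.memLp_self {f g : ℝ → ℂ} (h : IsW21 f g) :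
    MemLp f 2 (volume.restrict (Set.Icc (0 : ℝ) 1)) := by
  obtain ⟨C, hC⟩ := isCompact_Icc.exists_bound_of_continuousOn h.continuousOn
  exact MemLp.of_bound (h.continuousOn.aestronglyMeasurable measurableSet_Icc) C
    ((ae_restrict_iff' measurableSet_Icc).2 (Filter.Eventually.of_forall hC))

theorem IsW21.add {f g f' g' : ℝ → ℂ} (h : IsW21 f g) (h' : IsW21 f' g') :
    IsW21 (f + f') (g + g') := by
  refine ⟨h.memLp.add h'.memLp, fun t ht => ?_⟩
  simp only [Pi.add_apply]
  rw [intervalIntegral.integral_add (h.intervalIntegrable ht) (h'.intervalIntegrable ht),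
    h.eq t ht, h'.eq t ht]
  ring

theorem IsW21.smul {f g : ℝ → ℂ} (c : ℂ) (h : IsW21 f g) : IsW21 (c • f) (c • g) := by
  refine ⟨h.memLp.const_smul c, fun t ht => ?_⟩
  simp only [Pi.smul_apply]
  rw [intervalIntegral.integral_smul, h.eq t ht, smul_add]

/-- A derivative of the zero function is zero. -/
theorem IsW21.eq_zero {f g : ℝ → ℂ} (h : IsW21 f g)
    (hf : ∀ t ∈ Set.Icc (0 : ℝ) 1, f t = 0) :
    g =ᵐ[volume.restrict (Set.Icc (0 : ℝ) 1)] 0 := by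
  have h0 : ∀ t ∈ Set.Icc (0 : ℝ) 1, ∫ s in (0 : ℝ)..t, g s = 0 := by
    intro t ht
    have := h.eq t ht
    rw [hf t ht, hf 0 ⟨le_rfl, zero_le_one⟩] at this
    simpa using this.symm
  have hgi : IntervalIntegrable g volume 0 1 := h.intervalIntegrable ⟨zero_le_one, le_rfl⟩
  have h1 := hgi.ae_hasDerivAt_integral
  rw [Filter.EventuallyEq, ae_restrict_iff' measurableSet_Icc]
  have hne : ∀ᵐ t : ℝ, t ≠ 0 ∧ t ≠ 1 := by
    have a0 : ∀ᵐ t : ℝ, t ≠ 0 := by simp [ae_iff]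
    have a1 : ∀ᵐ t : ℝ, t ≠ 1 := by simp [ae_iff]
    exact a0.and a1
  filter_upwards [h1, hne] with t ht hne htI
  have hd := ht (by rwa [Set.uIcc_of_le zero_le_one]) 0 (by simp)
  have hev : (fun x => ∫ s in (0 : ℝ)..x, g s) =ᶠ[nhds t] fun _ => 0 := by
    have : Set.Ioo (0 : ℝ) 1 ∈ nhds t :=
      Ioo_mem_nhds (lt_of_le_of_ne htI.1 hne.1.symm) (lt_of_le_of_ne htI.2 hne.2)
    filter_upwards [this] with x hx
    exact h0 x ⟨hx.1.le, hx.2.le⟩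
  exact (hd.congr_of_eventuallyEq hev.symm).unique (hasDerivAt_const t 0)

theorem eq_zero_of_ae {f : ℝ → ℂ} (hc : ContinuousOn f (Set.Icc 0 1))
    (h : f =ᵐ[volume.restrict (Set.Icc (0 : ℝ) 1)] 0) : ∀ t ∈ Set.Icc (0 : ℝ) 1, f t = 0 := by
  intro t ht
  exact Measure.eqOn_Icc_of_ae_eq volume zero_ne_one h hc continuousOn_const ht

theorem integral_add_sq_le {f g : ℝ → ℂ} (hf : MemLp f 2 (volume.restrict (Set.Icc (0 : ℝ) 1)))
    (hg : MemLp g 2 (volume.restrict (Set.Icc (0 : ℝ) 1))) :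
    ∫ t in Set.Icc (0 : ℝ) 1, ‖(f + g) t‖ ^ 2 ≤
      2 * (∫ t in Set.Icc (0 : ℝ) 1, ‖f t‖ ^ 2) + 2 * ∫ t in Set.Icc (0 : ℝ) 1, ‖g t‖ ^ 2 := by
  have hf' := hf.integrable_norm_pow (p := 2) (by norm_num)
  have hg' := hg.integrable_norm_pow (p := 2) (by norm_num)
  have hfg := (hf.add hg).integrable_norm_pow (p := 2) (by norm_num)
  rw [← integral_const_mul, ← integral_const_mul,
    ← integral_add (hf'.const_mul 2) (hg'.const_mul 2)]
  refine integral_mono hfg ((hf'.const_mul 2).add (hg'.const_mul 2)) fun t => ?_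
  have h1 := norm_add_le (f t) (g t)
  have h2 := norm_nonneg (f t + g t)
  simp only [Pi.add_apply]
  nlinarith [sq_nonneg (‖f t‖ - ‖g t‖)]

theorem integral_smul_sq (c : ℂ) (f : ℝ → ℂ) :
    ∫ t in Set.Icc (0 : ℝ) 1, ‖(c • f) t‖ ^ 2 =
      ‖c‖ ^ 2 * ∫ t in Set.Icc (0 : ℝ) 1, ‖f t‖ ^ 2 := by
  rw [← integral_const_mul]
  simp [mul_pow]

theorem IsAdmissible.add {y y1 y2 z z1 z2 : P.Edge → ℝ → ℂ} (hy : P.IsAdmissible y y1 y2)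
    (hz : P.IsAdmissible z z1 z2) : P.IsAdmissible (y + z) (y1 + z1) (y2 + z2) where
  first e := (hy.first e).add (hz.first e)
  second e := (hy.second e).add (hz.second e)
  summable := by
    refine Summable.of_nonneg_of_le (fun e => ?_) (fun e => ?_)
      ((hy.summable.mul_left 2).add (hz.summable.mul_left 2))
    · have := (weight_pos e).le
      positivity
    · have h0 := integral_add_sq_le (hy.first e).memLp_self (hz.first e).memLp_self
      have h1 := integral_add_sq_le (hy.first e).memLp (hz.first e).memLp
      have h2 := integral_add_sq_le (hy.second e).memLp (hz.second e).memLp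
      have h3 := mul_le_mul_of_nonneg_left (add_le_add (add_le_add h0 h1) h2) (weight_pos e).le
      refine h3.trans (le_of_eq ?_)
      ring
  gluing e he l := by simp [hy.gluing e he l, hz.gluing e he l]
  kirchhoff e he := by
    convert (hy.kirchhoff e he).add (hz.kirchhoff e he) using 1
    · ext l; simp [mul_add]
    · simp; ring
  initial := by simp [hy.initial, hz.initial]
  terminal e he := by simp [hy.terminal e he, hz.terminal e he]

theorem IsAdmissible.smul (c : ℂ) {y y1 y2 : P.Edge → ℝ → ℂ} (hy : P.IsAdmissible y y1 y2) :
    P.IsAdmissible (c • y) (c • y1) (c • y2) where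
  first e := (hy.first e).smul c
  second e := (hy.second e).smul c
  summable := by
    refine (hy.summable.mul_left (‖c‖ ^ 2)).congr fun e => ?_
    simp only [Pi.smul_apply c y, Pi.smul_apply c y1, Pi.smul_apply c y2, integral_smul_sq]
    ring
  gluing e he l := by simp [hy.gluing e he l]
  kirchhoff e he := by
    have h := (hy.kirchhoff e he).mul_left c
    have h1 : (fun l => c * ((P.p l : ℂ) * y1 (P.child e he l) 0)) =
        fun l => (P.p l : ℂ) * (c • y1) (P.child e he l) 0 := by
      funext l
      simp only [Pi.smul_apply, smul_eq_mul]
      ring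
    have h2 : c * (y1 e 1 + P.kirchhoffCoeff e * y e 1) =
        (c • y1) e 1 + P.kirchhoffCoeff e * (c • y) e 1 := by
      simp only [Pi.smul_apply, smul_eq_mul]
      ring
    rw [← h1, ← h2]
    exact h
  initial := by simp [hy.initial]
  terminal e he := by simp [hy.terminal e he]

theorem isAdmissible_zero : P.IsAdmissible 0 0 0 where
  first e := ⟨MemLp.zero, by simp⟩
  second e := ⟨MemLp.zero, by simp⟩
  summable := by simp
  gluing e he l := by simp
  kirchhoff e he := by simp
  initial := by simp
  terminal e he := by simp

theorem Represents.add {f g : P.L2α} {y z : P.Edge → ℝ → ℂ} (hf : P.Represents f y)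
    (hg : P.Represents g z) : P.Represents (f + g) (y + z) := by
  intro e
  rw [lp.coeFn_add, Pi.add_apply]
  exact (Lp.coeFn_add _ _).trans ((hf e).add (hg e))

theorem Represents.smul (c : ℂ) {f : P.L2α} {y : P.Edge → ℝ → ℂ} (hf : P.Represents f y) :
    P.Represents (c • f) (c • y) := by
  intro e
  rw [lp.coeFn_smul, Pi.smul_apply]
  exact (Lp.coeFn_smul _ _).trans ((hf e).const_smul c)

theorem represents_zero : P.Represents 0 0 := by
  intro e
  rw [lp.coeFn_zero, Pi.zero_apply]
  exact Lp.coeFn_zero _ _ _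

theorem Rel.add {f h f' h' : P.L2α} (a : P.Rel f h) (a' : P.Rel f' h') :
    P.Rel (f + f') (h + h') := by
  obtain ⟨y, y1, y2, hy, hf, hh⟩ := a
  obtain ⟨z, z1, z2, hz, hf', hh'⟩ := a'
  refine ⟨_, _, _, hy.add hz, hf.add hf', ?_⟩
  convert hh.add hh' using 1
  ext e t
  simp only [diffExpr, Pi.add_apply]
  ring

theorem Rel.smul (c : ℂ) {f h : P.L2α} (a : P.Rel f h) : P.Rel (c • f) (c • h) := by
  obtain ⟨y, y1, y2, hy, hf, hh⟩ := a
  refine ⟨_, _, _, hy.smul c, hf.smul c, ?_⟩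
  convert hh.smul c using 1
  ext e t
  simp only [diffExpr, Pi.smul_apply, smul_eq_mul]
  ring

theorem Rel.eq_zero {h : P.L2α} (a : P.Rel 0 h) : h = 0 := by
  obtain ⟨y, y1, y2, hy, hf, hh⟩ := a
  ext e : 2
  rw [lp.coeFn_zero, Pi.zero_apply, Lp.eq_zero_iff_ae_eq_zero]
  have e0 := (hf e).symm.trans (represents_zero e)
  have e3 := hh e
  rw [Filter.EventuallyEq, edgeMeasure_ae] at e0 e3 ⊢
  have e0' := eq_zero_of_ae (hy.first e).continuousOn e0
  have e1 := eq_zero_of_ae (hy.second e).continuousOn ((hy.first e).eq_zero e0')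
  have e2 := (hy.second e).eq_zero e1
  filter_upwards [e3, e2, ae_restrict_mem measurableSet_Icc] with t h3 h2 ht
  rw [h3]
  simp [diffExpr, e0' t ht, e1 t ht, h2]

theorem Rel.unique {f h h' : P.L2α} (a : P.Rel f h) (a' : P.Rel f h') : h = h' := by
  have := a.add (a'.smul (-1))
  rw [neg_one_smul, neg_one_smul, add_neg_cancel] at this
  exact add_neg_eq_zero.1 this.eq_zero

theorem coeff_bdd (P : TimeTree) : ∃ M : ℝ, 0 ≤ M ∧ ∀ e : P.Edge, ‖P.coeff e‖ ≤ M := by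
  obtain ⟨M, hM⟩ := P.θ_bdd
  refine ⟨max M ‖P.b₁‖, le_max_of_le_right (norm_nonneg _), fun e => ?_⟩
  obtain ⟨w, hw⟩ := e
  cases w with
  | nil => exact le_max_right _ _
  | cons l w => exact (hM l).trans (le_max_left _ _)

theorem integral_diffExpr_le {b : ℂ} {M : ℝ} (hb : ‖b‖ ≤ M) {y y1 y2 : ℝ → ℂ}
    (h : IsW21 y y1) (h1 : IsW21 y1 y2) :
    MemLp (diffExpr b y y1 y2) 2 (volume.restrict (Set.Icc (0 : ℝ) 1)) ∧
    ∫ t in Set.Icc (0 : ℝ) 1, ‖diffExpr b y y1 y2 t‖ ^ 2 ≤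
      (4 + 16 * M ^ 2 + 2 * M ^ 4) * ((∫ t in Set.Icc (0 : ℝ) 1, ‖y t‖ ^ 2) +
        (∫ t in Set.Icc (0 : ℝ) 1, ‖y1 t‖ ^ 2) + ∫ t in Set.Icc (0 : ℝ) 1, ‖y2 t‖ ^ 2) := by
  have hM : 0 ≤ M := (norm_nonneg b).trans hb
  set c1 : ℂ := -(2 * Complex.I * (b.im : ℂ)) with hc1
  set c0 : ℂ := ((‖b‖ ^ 2 : ℝ) : ℂ) with hc0
  have hd : diffExpr b y y1 y2 = ((-1 : ℂ) • y2 + c1 • y1) + c0 • y := by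
    ext t
    simp only [diffExpr, Pi.add_apply, Pi.smul_apply, smul_eq_mul, hc1, hc0]
    ring
  have m2 := h1.memLp.const_smul (-1 : ℂ)
  have m1 := h.memLp.const_smul c1
  have m0 := h.memLp_self.const_smul c0
  have n1 : ‖c1‖ ^ 2 ≤ 4 * M ^ 2 := by
    have := (Complex.abs_im_le_norm b).trans hb
    have h3 : ‖c1‖ = 2 * |b.im| := by simp [hc1]
    rw [h3]
    nlinarith [abs_nonneg b.im]
  have n0 : ‖c0‖ ^ 2 ≤ M ^ 4 := by
    have h3 : ‖c0‖ = ‖b‖ ^ 2 := by simp [hc0]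
    rw [h3, ← pow_mul]
    exact pow_le_pow_left₀ (norm_nonneg _) hb 4
  rw [hd]
  refine ⟨(m2.add m1).add m0, ?_⟩
  have i1 := integral_add_sq_le (m2.add m1) m0
  have i2 := integral_add_sq_le m2 m1
  rw [integral_smul_sq] at i1
  rw [integral_smul_sq, integral_smul_sq] at i2
  have p0 : 0 ≤ ∫ t in Set.Icc (0 : ℝ) 1, ‖y t‖ ^ 2 := by positivity
  have p1 : 0 ≤ ∫ t in Set.Icc (0 : ℝ) 1, ‖y1 t‖ ^ 2 := by positivity
  have p2 : 0 ≤ ∫ t in Set.Icc (0 : ℝ) 1, ‖y2 t‖ ^ 2 := by positivity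
  have q1 := mul_le_mul_of_nonneg_right n1 p1
  have q0 := mul_le_mul_of_nonneg_right n0 p0
  have r2 : ‖(-1 : ℂ)‖ ^ 2 = 1 := by simp
  rw [r2] at i2
  have s1 : 0 ≤ M ^ 2 := by positivity
  have s2 : 0 ≤ M ^ 4 := by positivity
  nlinarith [mul_nonneg s1 p0, mul_nonneg s1 p2, mul_nonneg s2 p1, mul_nonneg s2 p2]

theorem norm_toLp_sq (e : P.Edge) {f : ℝ → ℂ} (hf : MemLp f 2 (P.edgeMeasure e)) :
    ‖hf.toLp f‖ ^ 2 = P.weight e * ∫ t in Set.Icc (0 : ℝ) 1, ‖f t‖ ^ 2 := by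
  have h1 : ((‖hf.toLp f‖ ^ 2 : ℝ) : ℂ) = inner ℂ (hf.toLp f) (hf.toLp f) := by
    rw [inner_self_eq_norm_sq_to_K]; simp
  have h2 : inner ℂ (hf.toLp f) (hf.toLp f) =
      ((∫ t, ‖f t‖ ^ 2 ∂(P.edgeMeasure e) : ℝ) : ℂ) := by
    rw [L2.inner_def, ← integral_complex_ofReal]
    refine integral_congr_ae ?_
    filter_upwards [hf.coeFn_toLp] with t ht
    rw [ht, inner_self_eq_norm_sq_to_K]
    simp
  rw [h2] at h1
  have h3 := Complex.ofReal_injective h1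
  rw [h3, edgeMeasure, integral_smul_measure, ENNReal.toReal_ofReal (weight_pos e).le, smul_eq_mul]

/-- The differential expressions map admissible tuples to `L_{2,α}`. -/
theorem exists_rel {f : P.L2α} {y y1 y2 : P.Edge → ℝ → ℂ} (hy : P.IsAdmissible y y1 y2)
    (hf : P.Represents f y) : ∃ h, P.Rel f h := by
  obtain ⟨M, -, hM⟩ := coeff_bdd P
  have key e := integral_diffExpr_le (hM e) (hy.first e) (hy.second e)
  have hm : ∀ e, MemLp (diffExpr (P.coeff e) (y e) (y1 e) (y2 e)) 2 (P.edgeMeasure e) :=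
    fun e => (key e).1.smul_measure ENNReal.ofReal_ne_top
  have hl : Memℓp (fun e => (hm e).toLp _) 2 := by
    rw [memℓp_gen_iff (by norm_num)]
    refine Summable.of_nonneg_of_le (fun e => by positivity) (fun e => ?_)
      (hy.summable.mul_left (4 + 16 * M ^ 2 + 2 * M ^ 4))
    simp only [ENNReal.toReal_ofNat, Real.rpow_ofNat]
    rw [norm_toLp_sq]
    have := mul_le_mul_of_nonneg_left (key e).2 (weight_pos e).le
    refine this.trans (le_of_eq ?_)
    ring
  exact ⟨⟨_, hl⟩, y, y1, y2, hy, hf, fun e => (hm e).coeFn_toLp⟩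

variable (P)

/-- The domain: the (classes of) tuples in `W^2_{2,α}` that satisfy the gluing and Kirchhoff
conditions and the zero initial and terminal conditions. -/
def domain : Submodule ℂ P.L2α where
  carrier := {f | ∃ y y1 y2, P.IsAdmissible y y1 y2 ∧ P.Represents f y}
  zero_mem' := ⟨0, 0, 0, isAdmissible_zero, represents_zero⟩
  add_mem' := by
    rintro f g ⟨y, y1, y2, hy, hf⟩ ⟨z, z1, z2, hz, hg⟩
    exact ⟨_, _, _, hy.add hz, hf.add hg⟩
  smul_mem' := by
    rintro c f ⟨y, y1, y2, hy, hf⟩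
    exact ⟨_, _, _, hy.smul c, hf.smul c⟩

variable {P} in
theorem exists_of_mem_domain (f : P.domain) : ∃ h, P.Rel f h := by
  obtain ⟨f, y, y1, y2, hy, hf⟩ := f
  exact exists_rel hy hf

/-- The operator in `L_{2,α}` generated by the differential expressions: it takes the tuple
`[y_e]` of its domain to the tuple `[-y_e'' - 2i (Im b_e) y_e' + |b_e|² y_e]`. -/
def operator : P.L2α →ₗ.[ℂ] P.L2α where
  domain := P.domain
  toFun :=
    { toFun := fun f => (exists_of_mem_domain f).choose
      map_add' := fun f g => (exists_of_mem_domain (f + g)).choose_spec.unique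
        ((exists_of_mem_domain f).choose_spec.add (exists_of_mem_domain g).choose_spec)
      map_smul' := fun c f => (exists_of_mem_domain (c • f)).choose_spec.unique
        ((exists_of_mem_domain f).choose_spec.smul c) }

/-- The value of the operator on an admissible tuple. -/
theorem operator_rel (f : P.operator.domain) : P.Rel f (P.operator f) :=
  (exists_of_mem_domain f).choose_spec

end TimeTree

end

/-!
# Self-adjointness and positivity of the operator on the tree

The operator is `D* D`, where `D y = [y_e' + b_e y_e]` acts on the continuous tuples in `W^1` that
vanish at the root and at the ends of the last tier. Indeed `-y'' - 2 i (Im b) y' + |b|² y` is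
`-F' + conj b F` for the flux `F = y' + b y`, and, since the values of `y` are glued and `b` is
`θ l` on the `l`-th child, the Kirchhoff condition with the coefficient `β` says that the flux is
conserved at each internal vertex, `F_e(1) = ∑ p_l F_{e,l}(0)` (`TimeTree.kirchhoff_iff`).

A tuple `y` is encoded by its derivative `d`: `TimeTree.primitiveOp` recovers `y` from `d`,
`TimeTree.fluxOp` takes `d` to `D y`, both are bounded on `L_{2,α}`, and the terminal conditions
define a closed subspace `TimeTree.formDomain`. The weights of the children of an edge add up to the
weight of the edge, so a Gronwall argument over the finitely many tiers
(`TimeTree.exists_poincare`) bounds `y` and `d` by the flux (`TimeTree.exists_norm_le_fluxOp`).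

Green's formula (`TimeTree.hasSum_green`) gives `⟨D z, D y⟩ = ⟨z, L y⟩` for `y` in the domain of `L`
and `z` in the form domain (`TimeTree.Rel.exists_weak`). Hence `L` is symmetric and, by the lower
bound for the flux, positive definite. Conversely, the Lax-Milgram argument solves
`⟨D z, D y⟩ = ⟨z, h⟩` for every `h` (`TimeTree.exists_weak_solution`). Test tuples supported on one
edge show that the flux of the solution is absolutely continuous with `-F' + conj b F = h`
(`TimeTree.exists_flux`), and test tuples supported around one vertex give the Kirchhoff condition
(`TimeTree.hasSum_flux`), so `L y = h` and `L` is surjective. A symmetric surjective operator is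
densely defined and self-adjoint.
-/

noncomputable section

namespace TimeTree

/-- Lebesgue measure on the interval `[0, 1]` that parametrizes every edge. -/
local notation "μ₀₁" => (volume.restrict (Set.Icc (0 : ℝ) 1) : Measure ℝ)

/-! ### Absolutely continuous functions on an edge -/

theorem integral_Icc_eq_intervalIntegral (g : ℝ → ℂ) : ∫ t, g t ∂μ₀₁ = ∫ t in (0 : ℝ)..1, g t := by
  rw [intervalIntegral.integral_of_le zero_le_one, integral_Icc_eq_integral_Ioc]

theorem isW21_primitive {g : ℝ → ℂ} (hg : MemLp g 2 μ₀₁) (c : ℂ) :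
    IsW21 (fun t => c + ∫ s in (0 : ℝ)..t, g s) g :=
  ⟨hg, fun t _ => by simp⟩

theorem intervalIntegral_congr_ae_unit {g g' : ℝ → ℂ} (h : g' =ᵐ[μ₀₁] g) {t : ℝ}
    (ht : t ∈ Set.Icc (0 : ℝ) 1) : ∫ s in (0 : ℝ)..t, g' s = ∫ s in (0 : ℝ)..t, g s := by
  rw [Filter.EventuallyEq, ae_restrict_iff' measurableSet_Icc] at h
  refine intervalIntegral.integral_congr_ae ?_
  filter_upwards [h] with s hs hst
  rw [Set.uIoc_of_le ht.1] at hst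
  exact hs ⟨hst.1.le, hst.2.trans ht.2⟩

theorem IsW21.congr {f g f' g' : ℝ → ℂ} (h : IsW21 f g)
    (hf : ∀ t ∈ Set.Icc (0 : ℝ) 1, f' t = f t) (hg : g' =ᵐ[μ₀₁] g) : IsW21 f' g' := by
  refine ⟨(memLp_congr_ae hg).2 h.memLp, fun t ht => ?_⟩
  rw [hf t ht, hf 0 ⟨le_rfl, zero_le_one⟩, intervalIntegral_congr_ae_unit hg ht, h.eq t ht]

theorem IsW21.conj {f g : ℝ → ℂ} (h : IsW21 f g) :
    IsW21 (fun t => starRingEnd ℂ (f t)) (fun t => starRingEnd ℂ (g t)) := by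
  refine ⟨h.memLp.star, fun t ht => ?_⟩
  rw [intervalIntegral.intervalIntegral_conj, ← map_add, h.eq t ht]

theorem absolutelyContinuous_primitive {g : ℝ → ℂ} (hg : IntervalIntegrable g volume 0 1) :
    AbsolutelyContinuousOnInterval (fun t => ∫ s in (0 : ℝ)..t, g s) 0 1 := by
  have hN := hg.norm.absolutelyContinuousOnInterval_intervalIntegral (c := 0) (by simp)
  rw [absolutelyContinuousOnInterval_iff] at hN ⊢
  intro ε hε
  obtain ⟨δ, hδ, h⟩ := hN ε hε
  refine ⟨δ, hδ, fun E hE hlt => (Finset.sum_le_sum fun i hi => ?_).trans_lt (h E hE hlt)⟩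
  have hint : ∀ t ∈ Set.uIcc (0 : ℝ) 1, IntervalIntegrable g volume 0 t := fun t ht =>
    hg.mono_set (Set.uIcc_subset_uIcc Set.left_mem_uIcc ht)
  obtain ⟨ha, hb⟩ := hE.1 i hi
  rw [dist_eq_norm, Real.dist_eq,
    intervalIntegral.integral_interval_sub_left (hint _ ha) (hint _ hb),
    intervalIntegral.integral_interval_sub_left (hint _ ha).norm (hint _ hb).norm]
  exact intervalIntegral.norm_integral_le_abs_integral_norm

/-- The product rule. Both sides are absolutely continuous with the same derivative almost
everywhere. -/
theorem IsW21.mul {f g f' g' : ℝ → ℂ} (h : IsW21 f g) (h' : IsW21 f' g') :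
    IsW21 (fun t => f t * f' t) (fun t => g t * f' t + f t * g' t) := by
  have hbd : ∀ {u v : ℝ → ℂ}, ContinuousOn u (Set.Icc 0 1) → MemLp v 2 μ₀₁ →
      MemLp (fun t => u t * v t) 2 μ₀₁ := by
    intro u v hu hv
    obtain ⟨C, hC⟩ := isCompact_Icc.exists_bound_of_continuousOn hu
    have hu' : MemLp u ⊤ μ₀₁ := memLp_top_of_bound (hu.aestronglyMeasurable measurableSet_Icc) C
      ((ae_restrict_iff' measurableSet_Icc).2 (Filter.Eventually.of_forall hC))
    exact hv.mul hu'
  have hmem : MemLp (fun t => g t * f' t + f t * g' t) 2 μ₀₁ := by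
    refine MemLp.add ?_ (hbd h.continuousOn h'.memLp)
    simpa only [mul_comm] using hbd h'.continuousOn h.memLp
  refine ⟨hmem, ?_⟩
  have h1 : (1 : ℝ) ∈ Set.Icc (0 : ℝ) 1 := ⟨zero_le_one, le_rfl⟩
  have hg := h.intervalIntegrable h1
  have hg' := h'.intervalIntegrable h1
  have hp := (isW21_primitive hmem 0).intervalIntegrable h1
  set F : ℝ → ℂ := fun t => f 0 + ∫ s in (0 : ℝ)..t, g s with hF
  set F' : ℝ → ℂ := fun t => f' 0 + ∫ s in (0 : ℝ)..t, g' s with hF'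
  set G : ℝ → ℂ := fun t => ∫ s in (0 : ℝ)..t, (g s * f' s + f s * g' s) with hG
  have aconst : ∀ c : ℂ, AbsolutelyContinuousOnInterval (fun _ : ℝ => c) 0 1 := fun c =>
    ((LipschitzWith.const c).lipschitzOnWith (s := Set.uIcc 0 1)).absolutelyContinuousOnInterval
  have aF : AbsolutelyContinuousOnInterval F 0 1 :=
    (aconst _).add (absolutelyContinuous_primitive hg)
  have aF' : AbsolutelyContinuousOnInterval F' 0 1 :=
    (aconst _).add (absolutelyContinuous_primitive hg')
  have aD : AbsolutelyContinuousOnInterval (F • F' - G) 0 1 :=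
    (aF.smul aF').sub (absolutelyContinuous_primitive hp)
  have hder : ∀ᵐ t : ℝ, t ∈ Set.uIcc (0 : ℝ) 1 → HasDerivAt (F • F' - G) 0 t := by
    filter_upwards [hg.ae_hasDerivAt_integral, hg'.ae_hasDerivAt_integral,
      hp.ae_hasDerivAt_integral] with t e1 e2 e3 ht
    have d1 : HasDerivAt F (g t) t := (e1 ht 0 (by simp)).const_add _
    have d2 : HasDerivAt F' (g' t) t := (e2 ht 0 (by simp)).const_add _
    have d3 : HasDerivAt G _ t := e3 ht 0 (by simp)
    have d4 := (d1.mul d2).sub d3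
    rw [Set.uIcc_of_le zero_le_one] at ht
    have q1 : F t = f t := (h.eq t ht).symm
    have q2 : F' t = f' t := (h'.eq t ht).symm
    rw [q1, q2, sub_self] at d4
    exact d4
  obtain ⟨C, hC⟩ := aD.const_of_ae_hasDerivAt_zero hder
  rw [Set.uIcc_of_le zero_le_one] at hC
  intro t ht
  have c0 := hC 0 ⟨le_rfl, zero_le_one⟩
  have ct := hC t ht
  have q1 : F t = f t := (h.eq t ht).symm
  have q2 : F' t = f' t := (h'.eq t ht).symm
  have ct' : f t * f' t - G t = C := by rw [← ct, ← q1, ← q2]; rfl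
  have c0' : f 0 * f' 0 = C := by rw [← c0]; simp [hF, hF', hG]
  rw [c0', ← ct']
  exact (sub_add_cancel _ _).symm

theorem IsW21.integral_eq_sub {f g : ℝ → ℂ} (h : IsW21 f g) : ∫ t, g t ∂μ₀₁ = f 1 - f 0 := by
  rw [integral_Icc_eq_intervalIntegral, h.eq 1 ⟨zero_le_one, le_rfl⟩]
  ring

/-- Integration by parts, in the form of the product rule for `f * conj z`. -/
theorem IsW21.integral_by_parts {f g z z' : ℝ → ℂ} (h : IsW21 f g) (hz : IsW21 z z') :
    ∫ t, (f t * starRingEnd ℂ (z' t) + g t * starRingEnd ℂ (z t)) ∂μ₀₁ =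
      f 1 * starRingEnd ℂ (z 1) - f 0 * starRingEnd ℂ (z 0) := by
  rw [← (h.mul hz.conj).integral_eq_sub]
  simp only [add_comm]

theorem isW21_exp (b : ℂ) :
    IsW21 (fun t => Complex.exp (b * t)) (fun t => b * Complex.exp (b * t)) := by
  have hc : Continuous fun t : ℝ => b * Complex.exp (b * t) := by fun_prop
  refine ⟨?_, fun t _ => ?_⟩
  · obtain ⟨C, hC⟩ := (isCompact_Icc (a := (0 : ℝ)) (b := 1)).exists_bound_of_continuousOn
      hc.continuousOn
    exact MemLp.of_bound hc.aestronglyMeasurable C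
      ((ae_restrict_iff' measurableSet_Icc).2 (Filter.Eventually.of_forall hC))
  · have hd : ∀ s ∈ Set.uIcc 0 t,
        HasDerivAt (fun t : ℝ => Complex.exp (b * t)) (b * Complex.exp (b * s)) s := by
      intro s _
      have h1 : HasDerivAt (fun z : ℂ => Complex.exp (b * z)) (Complex.exp (b * s) * b) (s : ℂ) := by
        simpa using ((hasDerivAt_id (s : ℂ)).const_mul b).cexp
      simpa [mul_comm] using h1.comp_ofReal
    rw [intervalIntegral.integral_eq_sub_of_hasDerivAt hd (hc.intervalIntegrable _ _)]
    ring

instance isProbabilityMeasure_unit : IsProbabilityMeasure μ₀₁ := ⟨by simp⟩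

theorem sq_integral_norm_le {g : ℝ → ℂ} (hg : MemLp g 2 μ₀₁) :
    (∫ t, ‖g t‖ ∂μ₀₁) ^ 2 ≤ ∫ t, ‖g t‖ ^ 2 ∂μ₀₁ := by
  set m := ∫ t, ‖g t‖ ∂μ₀₁ with hm
  have i2 := hg.integrable_norm_pow (p := 2) (by norm_num)
  have i1 : Integrable (fun t => ‖g t‖) μ₀₁ := (hg.integrable (by norm_num)).norm
  have h0 : 0 ≤ ∫ t, (‖g t‖ ^ 2 - 2 * m * ‖g t‖ + m ^ 2) ∂μ₀₁ :=
    integral_nonneg fun t => by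
      have := sq_nonneg (‖g t‖ - m)
      simp only [Pi.zero_apply]
      linarith
  have i3 : Integrable (fun t => ‖g t‖ ^ 2 - 2 * m * ‖g t‖) μ₀₁ := i2.sub (i1.const_mul _)
  rw [integral_add i3 (integrable_const _),
    integral_sub i2 (i1.const_mul _), integral_const_mul, ← hm] at h0
  simp at h0
  nlinarith

theorem norm_intervalIntegral_le {g : ℝ → ℂ} (hg : MemLp g 2 μ₀₁) {s t : ℝ}
    (hs : s ∈ Set.Icc (0 : ℝ) 1) (ht : t ∈ Set.Icc (0 : ℝ) 1) :
    ‖∫ r in s..t, g r‖ ≤ ∫ r, ‖g r‖ ∂μ₀₁ := by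
  refine intervalIntegral.norm_integral_le_integral_norm_uIoc.trans ?_
  refine setIntegral_mono_set (hg.integrable (by norm_num)).norm
    (Filter.Eventually.of_forall fun _ => norm_nonneg _) (LE.le.eventuallyLE ?_)
  intro r hr
  obtain ⟨h1, h2⟩ := hr
  exact ⟨(le_min hs.1 ht.1).trans h1.le, h2.trans (max_le hs.2 ht.2)⟩

/-- The equation `y' + b y = g` controls `y` by its initial value and `g`. -/
theorem IsW21.norm_sq_le {y y1 : ℝ → ℂ} (h : IsW21 y y1) {b : ℂ} {M : ℝ} (hb : ‖b‖ ≤ M) {t : ℝ}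
    (ht : t ∈ Set.Icc (0 : ℝ) 1) :
    ‖y t‖ ^ 2 ≤ 2 * Real.exp (2 * M) ^ 2 *
      (‖y 0‖ ^ 2 + ∫ s, ‖y1 s + b * y s‖ ^ 2 ∂μ₀₁) := by
  have hM : 0 ≤ M := (norm_nonneg b).trans hb
  -- The integrating factor `exp (b t)` turns the equation into `(exp (b t) y)' = exp (b t) G`.
  have hexp : ∀ {c : ℂ} (_ : ‖c‖ ≤ M) {s : ℝ}, s ∈ Set.Icc (0 : ℝ) 1 →
      ‖Complex.exp (c * s)‖ ≤ Real.exp M := by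
    intro c hc s hs
    rw [Complex.norm_exp]
    refine Real.exp_le_exp.2 ((Complex.re_le_norm _).trans ?_)
    rw [norm_mul, Complex.norm_real, Real.norm_of_nonneg hs.1]
    nlinarith [norm_nonneg c, hs.1, hs.2]
  set G : ℝ → ℂ := fun s => y1 s + b * y s with hG
  have hGm : MemLp G 2 μ₀₁ := h.memLp.add (h.memLp_self.const_mul b)
  set A := ∫ s, ‖G s‖ ∂μ₀₁
  have hA : 0 ≤ A := integral_nonneg fun _ => norm_nonneg _
  have hA2 : A ^ 2 ≤ ∫ s, ‖G s‖ ^ 2 ∂μ₀₁ := sq_integral_norm_le hGm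
  have hprod := (isW21_exp b).mul h
  have hI : ‖∫ s in (0 : ℝ)..t, (b * Complex.exp (b * s) * y s + Complex.exp (b * s) * y1 s)‖
      ≤ Real.exp M * A := by
    refine (norm_intervalIntegral_le hprod.memLp ⟨le_rfl, zero_le_one⟩ ht).trans ?_
    rw [← integral_const_mul]
    refine setIntegral_mono_on (hprod.memLp.integrable (by norm_num)).norm
      ((hGm.integrable (by norm_num)).norm.const_mul _) measurableSet_Icc fun s hs => ?_
    have : b * Complex.exp (b * s) * y s + Complex.exp (b * s) * y1 s =
        Complex.exp (b * s) * G s := by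
      simp only [hG]; ring
    rw [this, norm_mul]
    exact mul_le_mul_of_nonneg_right (hexp hb hs) (norm_nonneg _)
  have heq := hprod.eq t ht
  simp only [Complex.ofReal_zero, mul_zero, Complex.exp_zero, one_mul] at heq
  have h2 : y t = Complex.exp (-b * t) * (Complex.exp (b * t) * y t) := by
    rw [← mul_assoc, ← Complex.exp_add]; simp
  have e1 : 1 ≤ Real.exp M := Real.one_le_exp hM
  have h3 : ‖y t‖ ≤ Real.exp (2 * M) * (‖y 0‖ + A) := by
    rw [h2, heq, norm_mul, two_mul, Real.exp_add, mul_assoc]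
    refine mul_le_mul (hexp (by simpa using hb) ht) ((norm_add_le _ _).trans ?_)
      (norm_nonneg _) (Real.exp_pos _).le
    nlinarith [norm_nonneg (y 0)]
  have h4 := pow_le_pow_left₀ (norm_nonneg _) h3 2
  rw [mul_pow] at h4
  have h5 : (‖y 0‖ + A) ^ 2 ≤ 2 * (‖y 0‖ ^ 2 + ∫ s, ‖G s‖ ^ 2 ∂μ₀₁) := by
    nlinarith [sq_nonneg (‖y 0‖ - A)]
  nlinarith [sq_nonneg (Real.exp (2 * M))]

theorem IsW21.trace_sq_le {y y1 : ℝ → ℂ} (h : IsW21 y y1) {t : ℝ}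
    (ht : t ∈ Set.Icc (0 : ℝ) 1) :
    ‖y t‖ ^ 2 ≤ 2 * ((∫ s, ‖y s‖ ^ 2 ∂μ₀₁) + ∫ s, ‖y1 s‖ ^ 2 ∂μ₀₁) := by
  have i0 := h.memLp_self.integrable_norm_pow (p := 2) (by norm_num)
  have key : ∀ s ∈ Set.Icc (0 : ℝ) 1,
      ‖y t‖ ^ 2 ≤ 2 * ‖y s‖ ^ 2 + 2 * ∫ s, ‖y1 s‖ ^ 2 ∂μ₀₁ := by
    intro s hs
    have h1 : y t = y s + ∫ r in s..t, y1 r := by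
      rw [h.eq t ht, h.eq s hs, add_assoc, intervalIntegral.integral_add_adjacent_intervals
        (h.intervalIntegrable hs) ((h.intervalIntegrable hs).symm.trans (h.intervalIntegrable ht))]
    have h2 := norm_intervalIntegral_le h.memLp hs ht
    have h3 := sq_integral_norm_le h.memLp
    have h4 : ‖y t‖ ≤ ‖y s‖ + ∫ r, ‖y1 r‖ ∂μ₀₁ := by
      rw [h1]; exact (norm_add_le _ _).trans (by gcongr)
    have h5 := pow_le_pow_left₀ (norm_nonneg _) h4 2
    nlinarith [sq_nonneg (‖y s‖ - ∫ r, ‖y1 r‖ ∂μ₀₁)]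
  have := setIntegral_mono_on (integrable_const (‖y t‖ ^ 2))
    ((i0.const_mul 2).add (integrable_const (2 * ∫ s, ‖y1 s‖ ^ 2 ∂μ₀₁))) measurableSet_Icc key
  rw [integral_const, integral_add' (i0.const_mul 2) (integrable_const _), integral_const_mul,
    integral_const] at this
  simp at this
  linarith

/-- The lemma of du Bois-Reymond: if `u' = r` in the sense of distributions on `(0, 1)`, then `u`
has an absolutely continuous representative with derivative `r`. -/
theorem exists_isW21_of_weak {u r : ℝ → ℂ} (hu : MemLp u 2 μ₀₁) (hr : MemLp r 2 μ₀₁)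
    (h : ∀ z z1, IsW21 z z1 → z 0 = 0 → z 1 = 0 →
      ∫ t, (u t * starRingEnd ℂ (z1 t) + r t * starRingEnd ℂ (z t)) ∂μ₀₁ = 0) :
    ∃ v, IsW21 v r ∧ v =ᵐ[μ₀₁] u := by
  have hR := isW21_primitive hr 0
  set R : ℝ → ℂ := fun t => 0 + ∫ s in (0 : ℝ)..t, r s with hRd
  have hw : MemLp (fun t => u t - R t) 2 μ₀₁ := hu.sub hR.memLp_self
  set c : ℂ := ∫ t, (u t - R t) ∂μ₀₁ with hc
  have hk : MemLp (fun t => u t - R t - c) 2 μ₀₁ := hw.sub (memLp_const c)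
  set k : ℝ → ℂ := fun t => u t - R t - c with hkd
  have hk0 : ∫ t, k t ∂μ₀₁ = 0 := by
    rw [hkd, integral_sub (hw.integrable (by norm_num)) (integrable_const _)]
    simp [hc]
  -- The test function is the primitive of `k`, which vanishes at both ends.
  have hz := isW21_primitive hk 0
  have hz1 : (0 : ℂ) + ∫ s in (0 : ℝ)..1, k s = 0 := by
    rw [← integral_Icc_eq_intervalIntegral, hk0, add_zero]
  have t1 := h _ _ hz (by simp) hz1
  have t2 := hR.integral_by_parts hz
  simp only [hz1, map_zero, mul_zero, intervalIntegral.integral_same, add_zero, sub_zero] at t2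
  have hkc : MemLp (fun t => starRingEnd ℂ (k t)) 2 μ₀₁ := hk.star
  have hzc := hz.conj.memLp_self
  have i1 : Integrable (fun t => u t * starRingEnd ℂ (k t)) μ₀₁ := hu.integrable_mul hkc
  have i2 : Integrable (fun t => R t * starRingEnd ℂ (k t)) μ₀₁ := hR.memLp_self.integrable_mul hkc
  have i3 : Integrable (fun t => r t * starRingEnd ℂ (0 + ∫ s in (0 : ℝ)..t, k s)) μ₀₁ :=
    hr.integrable_mul hzc
  have t3 : ∫ t, ((‖k t‖ ^ 2 : ℝ) : ℂ) ∂μ₀₁ = 0 := by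
    have e : ∀ t, ((‖k t‖ ^ 2 : ℝ) : ℂ) =
        (u t * starRingEnd ℂ (k t) + r t * starRingEnd ℂ (0 + ∫ s in (0 : ℝ)..t, k s))
        - (R t * starRingEnd ℂ (k t) + r t * starRingEnd ℂ (0 + ∫ s in (0 : ℝ)..t, k s))
        - c * starRingEnd ℂ (k t) := by
      intro t
      rw [Complex.ofReal_pow, ← Complex.mul_conj']
      simp only [hkd]
      ring
    simp only [e]
    have j1 : Integrable (fun t => u t * starRingEnd ℂ (k t) +
      r t * starRingEnd ℂ (0 + ∫ s in (0 : ℝ)..t, k s)) μ₀₁ := i1.add i3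
    have j2 : Integrable (fun t => R t * starRingEnd ℂ (k t) +
      r t * starRingEnd ℂ (0 + ∫ s in (0 : ℝ)..t, k s)) μ₀₁ := i2.add i3
    have j3 : Integrable (fun t => u t * starRingEnd ℂ (k t) +
      r t * starRingEnd ℂ (0 + ∫ s in (0 : ℝ)..t, k s) - (R t * starRingEnd ℂ (k t) +
      r t * starRingEnd ℂ (0 + ∫ s in (0 : ℝ)..t, k s))) μ₀₁ := j1.sub j2
    rw [integral_sub j3 ((hkc.integrable (by norm_num)).const_mul c),
      integral_sub j1 j2, t1, t2, integral_const_mul, integral_conj, hk0]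
    simp
  rw [integral_complex_ofReal, Complex.ofReal_eq_zero, integral_eq_zero_iff_of_nonneg
    (fun t => by positivity) (hk.integrable_norm_pow (p := 2) (by norm_num))] at t3
  refine ⟨fun t => c + ∫ s in (0 : ℝ)..t, r s, isW21_primitive hr c, ?_⟩
  filter_upwards [t3] with t ht
  have : k t = 0 := by simpa using ht
  simp only [hkd, hRd] at this
  linear_combination -this

/-! ### Sums over the edges of the tree -/

section Sums

open scoped ENNReal NNReal

variable {P : TimeTree}

theorem weight_child (e : P.Edge) (he : P.IsInner e) (l : ℕ) :
    P.weight (P.child e he l) = P.p l * P.weight e := by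
  simp [weight, child]

/-- Every edge is the root edge or a child of an inner edge, in exactly one way. -/
def edgeEquiv (P : TimeTree) : Unit ⊕ ({e : P.Edge // P.IsInner e} × ℕ) ≃ P.Edge where
  toFun
    | .inl _ => P.root
    | .inr x => P.child x.1.1 x.1.2 x.2
  invFun
    | ⟨[], _⟩ => .inl ()
    | ⟨l :: w, h⟩ => .inr (⟨⟨w, (Nat.lt_succ_self _).trans h⟩, h⟩, l)
  left_inv x := by cases x <;> rfl
  right_inv e := by
    obtain ⟨w, hw⟩ := e
    cases w <;> rfl

theorem edge_induction {motive : P.Edge → Prop} (root : motive P.root)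
    (child : ∀ e he l, motive e → motive (P.child e he l)) : ∀ e, motive e := by
  rintro ⟨w, hw⟩
  induction w with
  | nil => exact root
  | cons l w ih => exact child ⟨w, (Nat.lt_succ_self _).trans hw⟩ hw l (ih _)

theorem inner_or_leaf (e : P.Edge) : P.IsInner e ∨ P.IsLeaf e := by
  have := e.2
  simp only [IsInner, IsLeaf]
  omega

theorem tsum_edge_ennreal (f : P.Edge → ℝ≥0∞) :
    ∑' e, f e = f P.root + ∑' e : {e : P.Edge // P.IsInner e}, ∑' l, f (P.child e.1 e.2 l) := by
  rw [← P.edgeEquiv.tsum_eq, Summable.tsum_sum ENNReal.summable ENNReal.summable,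
    tsum_eq_single () fun x hx => absurd rfl hx]
  exact congrArg _ (ENNReal.tsum_prod (f := fun (e : {e : P.Edge // P.IsInner e}) l =>
    f (P.child e.1 e.2 l)))

theorem tsum_edge {f : P.Edge → ℂ} (hf : Summable f) :
    ∑' e, f e = f P.root + ∑' e : {e : P.Edge // P.IsInner e}, ∑' l, f (P.child e.1 e.2 l) := by
  have h' : Summable fun x : {e : P.Edge // P.IsInner e} × ℕ => f (P.child x.1.1 x.1.2 x.2) :=
    hf.comp_injective (P.edgeEquiv.injective.comp Sum.inr_injective)
  have h0 : HasSum (fun u : Unit => f (P.edgeEquiv (.inl u))) (f P.root) := hasSum_unique _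
  have h1 : HasSum (fun x => f (P.edgeEquiv (.inr x)))
      (∑' e : {e : P.Edge // P.IsInner e}, ∑' l, f (P.child e.1 e.2 l)) :=
    h'.tsum_prod ▸ h'.hasSum
  exact (P.edgeEquiv.hasSum_iff.1 (h0.sum h1)).tsum_eq

theorem tsum_p_ennreal (P : TimeTree) : ∑' l, ENNReal.ofReal (P.p l) = 1 := by
  rw [← ENNReal.ofReal_tsum_of_nonneg (fun l => (P.p_pos l).le) P.p_sum.summable,
    P.p_sum.tsum_eq, ENNReal.ofReal_one]

/-- A quantity on the edges that vanishes on the first edge, and grows by at most a factor and a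
source from each edge to its children, is controlled by the source. The weights of the children of
an edge add up to the weight of the edge, so each tier contributes a bounded amount. -/
theorem exists_tsum_weight_le (P : TimeTree) (C : ℝ≥0) : ∃ K : ℝ≥0, ∀ a G : P.Edge → ℝ≥0∞,
    a P.root = 0 → (∀ e he l, a (P.child e he l) ≤ C * (a e + G e)) →
    ∑' e, ENNReal.ofReal (P.weight e) * a e ≤ K * ∑' e, ENNReal.ofReal (P.weight e) * G e := by
  classical
  have tier : ∀ k : ℕ, ∃ K : ℝ≥0, ∀ a G : P.Edge → ℝ≥0∞,
      a P.root = 0 → (∀ e he l, a (P.child e he l) ≤ C * (a e + G e)) →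
      ∑' e : P.Edge, (if e.1.length = k then ENNReal.ofReal (P.weight e) * a e else 0) ≤
        K * ∑' e, ENNReal.ofReal (P.weight e) * G e := by
    intro k
    induction k with
    | zero =>
      refine ⟨0, fun a G h0 _ => le_of_eq ?_⟩
      rw [tsum_edge_ennreal]
      simp [h0, child]
    | succ k ih =>
      obtain ⟨K, hK⟩ := ih
      refine ⟨C * (K + 1), fun a G h0 h => ?_⟩
      rw [tsum_edge_ennreal]
      have hr : (if P.root.1.length = k + 1 then ENNReal.ofReal (P.weight P.root) * a P.root
          else 0) = 0 := by simp [root]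
      rw [hr, zero_add]
      calc ∑' e : {e : P.Edge // P.IsInner e}, ∑' l,
            (if (P.child e.1 e.2 l).1.length = k + 1 then
              ENNReal.ofReal (P.weight (P.child e.1 e.2 l)) * a (P.child e.1 e.2 l) else 0)
          ≤ ∑' e : {e : P.Edge // P.IsInner e}, ∑' l, ENNReal.ofReal (P.p l) *
            (C * ((if e.1.1.length = k then ENNReal.ofReal (P.weight e) * a e else 0) +
              ENNReal.ofReal (P.weight e) * G e)) := by
            refine ENNReal.tsum_le_tsum fun e => ENNReal.tsum_le_tsum fun l => ?_
            rw [weight_child, ENNReal.ofReal_mul (P.p_pos l).le]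
            by_cases hk : e.1.1.length = k
            · have hk' : (P.child e.1 e.2 l).1.length = k + 1 := by simp [child, hk]
              rw [if_pos hk', if_pos hk, ← mul_add, mul_assoc]
              refine mul_le_mul_right ?_ _
              calc _ ≤ ENNReal.ofReal (P.weight e) * (C * (a e + G e)) := by
                    gcongr
                    exact h _ _ _
                _ = _ := by ring
            · have hk' : ¬ (P.child e.1 e.2 l).1.length = k + 1 := by simp [child, hk]
              rw [if_neg hk']
              exact zero_le
        _ = ∑' e : {e : P.Edge // P.IsInner e},
            (C * ((if e.1.1.length = k then ENNReal.ofReal (P.weight e) * a e else 0) +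
              ENNReal.ofReal (P.weight e) * G e)) := by
            simp_rw [ENNReal.tsum_mul_right, tsum_p_ennreal, one_mul]
        _ ≤ ∑' e : P.Edge, (C * ((if e.1.length = k then ENNReal.ofReal (P.weight e) * a e else 0) +
              ENNReal.ofReal (P.weight e) * G e)) :=
            ENNReal.tsum_comp_le_tsum_of_injective Subtype.val_injective
              (fun e : P.Edge => (C : ℝ≥0∞) *
                ((if e.1.length = k then ENNReal.ofReal (P.weight e) * a e else 0) +
                  ENNReal.ofReal (P.weight e) * G e))
        _ ≤ C * (K * (∑' e, ENNReal.ofReal (P.weight e) * G e) +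
              ∑' e, ENNReal.ofReal (P.weight e) * G e) := by
            rw [ENNReal.tsum_mul_left, ENNReal.tsum_add]
            gcongr
            exact hK a G h0 h
        _ = _ := by push_cast; ring
  choose K hK using tier
  refine ⟨∑ k ∈ Finset.range P.T, K k, fun a G h0 h => ?_⟩
  have hsplit : ∀ e : P.Edge, ENNReal.ofReal (P.weight e) * a e =
      ∑ k ∈ Finset.range P.T,
        (if e.1.length = k then ENNReal.ofReal (P.weight e) * a e else 0) := by
    intro e
    rw [Finset.sum_ite_eq, if_pos (Finset.mem_range.2 e.2)]
  rw [tsum_congr hsplit, Summable.tsum_finsetSum fun _ _ => ENNReal.summable]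
  push_cast
  rw [Finset.sum_mul]
  exact Finset.sum_le_sum fun k _ => hK k a G h0 h

theorem exists_tsum_weight_le_real (P : TimeTree) {C : ℝ} (hC : 0 ≤ C) :
    ∃ K : ℝ, 0 ≤ K ∧ ∀ a G : P.Edge → ℝ, (∀ e, 0 ≤ a e) → (∀ e, 0 ≤ G e) →
    a P.root = 0 → (∀ e he l, a (P.child e he l) ≤ C * (a e + G e)) →
    Summable (fun e => P.weight e * G e) → Summable (fun e => P.weight e * a e) ∧
      ∑' e, P.weight e * a e ≤ K * ∑' e, P.weight e * G e := by
  obtain ⟨K, hK⟩ := exists_tsum_weight_le P C.toNNReal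
  refine ⟨K, K.2, fun a G ha hG h0 h hs => ?_⟩
  have hw : ∀ e : P.Edge, 0 ≤ P.weight e := fun e => (weight_pos e).le
  have key := hK (fun e => ENNReal.ofReal (a e)) (fun e => ENNReal.ofReal (G e)) (by simp [h0])
    (fun e he l => by
      rw [← ENNReal.ofReal_add (ha e) (hG e)]
      change _ ≤ ENNReal.ofReal C * _
      rw [← ENNReal.ofReal_mul hC]
      exact ENNReal.ofReal_le_ofReal (h e he l))
  simp_rw [← ENNReal.ofReal_mul (hw _)] at key
  have hGn : ∀ e, 0 ≤ P.weight e * G e := fun e => mul_nonneg (hw e) (hG e)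
  have han : ∀ e, 0 ≤ P.weight e * a e := fun e => mul_nonneg (hw e) (ha e)
  rw [← ENNReal.ofReal_tsum_of_nonneg hGn hs, ← ENNReal.ofReal_coe_nnreal,
    ← ENNReal.ofReal_mul K.coe_nonneg] at key
  have hsa : Summable fun e => P.weight e * a e := by
    have := ENNReal.summable_toReal (key.trans_lt ENNReal.ofReal_lt_top).ne
    refine this.congr fun e => ENNReal.toReal_ofReal (han e)
  refine ⟨hsa, ?_⟩
  rw [← ENNReal.ofReal_tsum_of_nonneg han hsa] at key
  exact (ENNReal.ofReal_le_ofReal_iff (mul_nonneg K.2 (tsum_nonneg hGn))).1 key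

theorem summable_weight_mul {F ζ : P.Edge → ℂ} (hF : Summable fun e => P.weight e * ‖F e‖ ^ 2)
    (hζ : Summable fun e => P.weight e * ‖ζ e‖ ^ 2) :
    Summable fun e => (P.weight e : ℂ) * (F e * ζ e) := by
  refine Summable.of_norm_bounded (hF.add hζ) fun e => ?_
  rw [norm_mul, norm_mul, Complex.norm_real, Real.norm_of_nonneg (weight_pos e).le, ← mul_add]
  refine mul_le_mul_of_nonneg_left ?_ (weight_pos e).le
  nlinarith [sq_nonneg (‖F e‖ - ‖ζ e‖), sq_nonneg (‖F e‖ + ‖ζ e‖)]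

/-- The boundary terms cancel at every vertex if the flux `F` satisfies the Kirchhoff condition and
`ζ` is continuous at the internal vertices and zero at the others. -/
theorem tsum_boundary_eq_zero {F0 F1 ζ0 ζ1 : P.Edge → ℂ}
    (hF0 : Summable fun e => P.weight e * ‖F0 e‖ ^ 2)
    (hF1 : Summable fun e => P.weight e * ‖F1 e‖ ^ 2)
    (hζ0 : Summable fun e => P.weight e * ‖ζ0 e‖ ^ 2)
    (hζ1 : Summable fun e => P.weight e * ‖ζ1 e‖ ^ 2)
    (hK : ∀ e he, HasSum (fun l => (P.p l : ℂ) * F0 (P.child e he l)) (F1 e))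
    (hg : ∀ e he l, ζ0 (P.child e he l) = ζ1 e) (h0 : ζ0 P.root = 0)
    (h1 : ∀ e, P.IsLeaf e → ζ1 e = 0) :
    ∑' e, (P.weight e : ℂ) * (F1 e * ζ1 e - F0 e * ζ0 e) = 0 := by
  have s0 := summable_weight_mul hF0 hζ0
  have s1 := summable_weight_mul hF1 hζ1
  have e0 : ∑' e, (P.weight e : ℂ) * (F0 e * ζ0 e) = ∑' e, (P.weight e : ℂ) * (F1 e * ζ1 e) := by
    rw [tsum_edge s0, h0, mul_zero, mul_zero, zero_add]
    have : ∀ e : {e : P.Edge // P.IsInner e}, ∑' l, (P.weight (P.child e.1 e.2 l) : ℂ) *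
        (F0 (P.child e.1 e.2 l) * ζ0 (P.child e.1 e.2 l)) =
        (P.weight e.1 : ℂ) * (F1 e.1 * ζ1 e.1) := by
      intro e
      have hs := ((hK e.1 e.2).mul_left ((P.weight e.1 : ℂ) * ζ1 e.1)).tsum_eq
      rw [mul_comm (F1 e.1), ← mul_assoc, ← hs]
      refine tsum_congr fun l => ?_
      rw [hg, weight_child]
      push_cast
      ring
    rw [tsum_congr this]
    refine tsum_subtype_eq_of_support_subset
      (f := fun e => (P.weight e : ℂ) * (F1 e * ζ1 e)) (s := {e | P.IsInner e}) fun e he => ?_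
    rcases inner_or_leaf e with h | h
    · exact h
    · simp [h1 e h] at he
  simp_rw [mul_sub]
  rw [s1.tsum_sub s0, e0, sub_self]

end Sums

/-! ### Elements of `L_{2,α}` and the tuples of functions that represent them -/

section Hilbert

variable {P : TimeTree}

theorem memLp_edgeMeasure_iff (e : P.Edge) {f : ℝ → ℂ} :
    MemLp f 2 (P.edgeMeasure e) ↔ MemLp f 2 μ₀₁ := by
  refine ⟨fun h => ?_, fun h => h.smul_measure ENNReal.ofReal_ne_top⟩
  have hw : ENNReal.ofReal (P.weight e) ≠ 0 := by simpa using weight_pos e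
  have h2 := h.smul_measure (c := (ENNReal.ofReal (P.weight e))⁻¹) (ENNReal.inv_ne_top.2 hw)
  rwa [edgeMeasure, smul_smul, ENNReal.inv_mul_cancel hw ENNReal.ofReal_ne_top, one_smul] at h2

theorem represents_iff {f : P.L2α} {y : P.Edge → ℝ → ℂ} :
    P.Represents f y ↔ ∀ e, (f e : ℝ → ℂ) =ᵐ[μ₀₁] y e := by
  simp only [Represents, Filter.EventuallyEq, edgeMeasure_ae]

theorem represents_self (f : P.L2α) : P.Represents f fun e => f e :=
  fun _ => Filter.EventuallyEq.rfl

theorem Represents.memLp {f : P.L2α} {y : P.Edge → ℝ → ℂ} (h : P.Represents f y) (e : P.Edge) :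
    MemLp (y e) 2 μ₀₁ :=
  (memLp_edgeMeasure_iff e).1 ((memLp_congr_ae (h e)).1 (Lp.memLp _))

theorem Represents.congr {f : P.L2α} {y z : P.Edge → ℝ → ℂ} (h : P.Represents f y)
    (hz : ∀ e, z e =ᵐ[μ₀₁] y e) : P.Represents f z := by
  rw [represents_iff] at h ⊢
  exact fun e => (h e).trans (hz e).symm

theorem Represents.ae_eq {f : P.L2α} {y z : P.Edge → ℝ → ℂ} (h : P.Represents f y)
    (h' : P.Represents f z) (e : P.Edge) : y e =ᵐ[μ₀₁] z e := by
  rw [represents_iff] at h h'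
  exact (h e).symm.trans (h' e)

theorem Represents.ext {f g : P.L2α} {y z : P.Edge → ℝ → ℂ} (h : P.Represents f y)
    (h' : P.Represents g z) (hyz : ∀ e, y e =ᵐ[μ₀₁] z e) : f = g := by
  ext e : 2
  exact Lp.ext ((h e).trans ((h'.congr hyz) e).symm)

theorem Represents.toLp_eq {f : P.L2α} {y : P.Edge → ℝ → ℂ} (h : P.Represents f y) (e : P.Edge) :
    ((memLp_edgeMeasure_iff e).2 (h.memLp e)).toLp (y e) = f e :=
  Lp.ext ((MemLp.coeFn_toLp _).trans (h e).symm)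

theorem Represents.hasSum_norm_sq {f : P.L2α} {y : P.Edge → ℝ → ℂ} (h : P.Represents f y) :
    HasSum (fun e => P.weight e * ∫ t, ‖y e t‖ ^ 2 ∂μ₀₁) (‖f‖ ^ 2) := by
  have h1 := lp.hasSum_norm (p := 2) (by norm_num) f
  simp only [ENNReal.toReal_ofNat, Real.rpow_ofNat] at h1
  refine h1.congr_fun fun e => ?_
  rw [← norm_toLp_sq e ((memLp_edgeMeasure_iff e).2 (h.memLp e)), h.toLp_eq]

theorem Represents.hasSum_inner {f g : P.L2α} {y z : P.Edge → ℝ → ℂ} (hf : P.Represents f y)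
    (hg : P.Represents g z) :
    HasSum (fun e => (P.weight e : ℂ) * ∫ t, z e t * starRingEnd ℂ (y e t) ∂μ₀₁)
      (inner ℂ f g) := by
  refine (lp.hasSum_inner f g).congr_fun fun e => ?_
  have : (inner ℂ (f e) (g e)) = ∫ t, z e t * starRingEnd ℂ (y e t) ∂(P.edgeMeasure e) := by
    rw [L2.inner_def]
    refine integral_congr_ae ?_
    filter_upwards [hf e, hg e] with t h1 h2
    rw [h1, h2, RCLike.inner_apply]
  rw [this, edgeMeasure, integral_smul_measure, ENNReal.toReal_ofReal (weight_pos e).le,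
    Complex.real_smul]

theorem exists_represents {y : P.Edge → ℝ → ℂ} (hm : ∀ e, MemLp (y e) 2 μ₀₁)
    (hs : Summable fun e => P.weight e * ∫ t, ‖y e t‖ ^ 2 ∂μ₀₁) : ∃ f, P.Represents f y := by
  have hm' := fun e => (memLp_edgeMeasure_iff e).2 (hm e)
  have hl : Memℓp (fun e => (hm' e).toLp _) 2 := by
    rw [memℓp_gen_iff (by norm_num)]
    simpa only [ENNReal.toReal_ofNat, Real.rpow_ofNat, norm_toLp_sq] using hs
  exact ⟨⟨_, hl⟩, fun e => (hm' e).coeFn_toLp⟩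

theorem norm_smul_apply_le (c : P.Edge → ℂ) {M : ℝ} (hc : ∀ e, ‖c e‖ ≤ M) (f : P.L2α)
    (e : P.Edge) : ‖c e • f e‖ ≤ ‖((M : ℂ) • f : P.L2α) e‖ := by
  rw [lp.coeFn_smul, Pi.smul_apply, norm_smul, norm_smul, Complex.norm_real]
  exact mul_le_mul_of_nonneg_right ((hc e).trans (Real.le_norm_self M)) (norm_nonneg _)

/-- Multiplication of a tuple by a bounded family of constants. -/
def mulCoeff (c : P.Edge → ℂ) {M : ℝ} (hc : ∀ e, ‖c e‖ ≤ M) : P.L2α →L[ℂ] P.L2α :=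
  LinearMap.mkContinuous
    { toFun := fun f => ⟨fun e => c e • f e,
        (lp.memℓp ((M : ℂ) • f)).mono' (norm_smul_apply_le c hc f)⟩
      map_add' := fun f g => by ext e : 2; exact smul_add _ _ _
      map_smul' := fun a f => by ext e : 2; simp [smul_comm a] } ‖M‖ fun f =>
    (lp.norm_mono (by norm_num) (norm_smul_apply_le c hc f)).trans_eq
      (by rw [norm_smul, Complex.norm_real])

theorem Represents.mulCoeff {f : P.L2α} {y : P.Edge → ℝ → ℂ} (h : P.Represents f y)
    (c : P.Edge → ℂ) {M : ℝ} (hc : ∀ e, ‖c e‖ ≤ M) :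
    P.Represents (mulCoeff c hc f) fun e t => c e * y e t := by
  intro e
  refine (Lp.coeFn_smul (c e) (f e)).trans ?_
  filter_upwards [h e] with t ht
  rw [Pi.smul_apply, ht, smul_eq_mul]

theorem norm_mulCoeff_le (c : P.Edge → ℂ) {M : ℝ} (hc : ∀ e, ‖c e‖ ≤ M) (f : P.L2α) :
    ‖mulCoeff c hc f‖ ≤ ‖M‖ * ‖f‖ :=
  ContinuousLinearMap.le_of_opNorm_le _ (LinearMap.mkContinuous_norm_le _ (norm_nonneg M) _) f

end Hilbert

/-! ### The tuple with a given derivative -/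

section Primitive

variable {P : TimeTree}

/-- The integral over the edge `e`. -/
def edgeIntegral (e : P.Edge) : P.L2α →L[ℂ] ℂ :=
  (P.weight e : ℂ)⁻¹ •
    (innerSL ℂ (((memLp_const (1 : ℂ)).smul_measure ENNReal.ofReal_ne_top :
      MemLp (fun _ => (1 : ℂ)) 2 (P.edgeMeasure e)).toLp _)).comp (lp.evalCLM ℂ _ 2 e)

theorem edgeIntegral_apply (e : P.Edge) {d : P.L2α} {k : P.Edge → ℝ → ℂ} (h : P.Represents d k) :
    edgeIntegral e d = ∫ t in (0 : ℝ)..1, k e t := by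
  have h1 : edgeIntegral e d = (P.weight e : ℂ)⁻¹ *
      ∫ t, inner ℂ ((((memLp_const (1 : ℂ)).smul_measure ENNReal.ofReal_ne_top :
        MemLp (fun _ => (1 : ℂ)) 2 (P.edgeMeasure e)).toLp _ : ℝ → ℂ) t) (d e t)
        ∂(P.edgeMeasure e) := rfl
  rw [h1]
  have h2 : ∀ᵐ t ∂(P.edgeMeasure e), inner ℂ ((((memLp_const (1 : ℂ)).smul_measure
      ENNReal.ofReal_ne_top : MemLp (fun _ => (1 : ℂ)) 2 (P.edgeMeasure e)).toLp _ : ℝ → ℂ) t)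
      (d e t) = k e t := by
    filter_upwards [MemLp.coeFn_toLp ((memLp_const (1 : ℂ)).smul_measure
      ENNReal.ofReal_ne_top : MemLp (fun _ => (1 : ℂ)) 2 (P.edgeMeasure e)), h e] with t h3 h4
    rw [h3, h4]
    simp
  rw [integral_congr_ae h2, ← integral_Icc_eq_intervalIntegral, edgeMeasure,
    integral_smul_measure, ENNReal.toReal_ofReal (weight_pos e).le, Complex.real_smul,
    inv_mul_cancel_left₀ (by exact_mod_cast (weight_pos e).ne')]

/-- The value at the beginning of an edge of the continuous tuple with a given derivative that
vanishes at the root: the sum of the integrals of the derivative over the edges before it. -/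
def startValue : (w : List ℕ) → w.length < P.T → (P.L2α →L[ℂ] ℂ)
  | [], _ => 0
  | _ :: w, h => startValue w ((Nat.lt_succ_self _).trans h) +
      edgeIntegral ⟨w, (Nat.lt_succ_self _).trans h⟩

/-- The continuous tuple with derivative `d` that vanishes at the root. -/
def primitive (d : P.L2α) (e : P.Edge) (t : ℝ) : ℂ :=
  startValue e.1 e.2 d + ∫ s in (0 : ℝ)..t, (d e : ℝ → ℂ) s

theorem isW21_primitive_edge (d : P.L2α) (e : P.Edge) : IsW21 (primitive d e) (d e) :=
  isW21_primitive ((represents_self d).memLp e) _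

theorem primitive_zero (d : P.L2α) (e : P.Edge) : primitive d e 0 = startValue e.1 e.2 d := by
  simp [primitive]

theorem primitive_root (d : P.L2α) : primitive d P.root 0 = 0 := by
  rw [primitive_zero]; rfl

theorem primitive_one (d : P.L2α) (e : P.Edge) :
    primitive d e 1 = startValue e.1 e.2 d + edgeIntegral e d := by
  rw [edgeIntegral_apply e (represents_self d), primitive]

theorem primitive_child (d : P.L2α) (e : P.Edge) (he : P.IsInner e) (l : ℕ) :
    primitive d (P.child e he l) 0 = primitive d e 1 := by
  rw [primitive_zero, primitive_one]; rfl

theorem primitive_unique {d : P.L2α} {z z1 : P.Edge → ℝ → ℂ} (hz : ∀ e, IsW21 (z e) (z1 e))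
    (hd : P.Represents d z1) (h0 : z P.root 0 = 0)
    (hg : ∀ e he l, z e 1 = z (P.child e he l) 0) (e : P.Edge) :
    ∀ t ∈ Set.Icc (0 : ℝ) 1, z e t = primitive d e t := by
  have step : ∀ e, z e 0 = primitive d e 0 → ∀ t ∈ Set.Icc (0 : ℝ) 1, z e t = primitive d e t := by
    intro e he t ht
    rw [(hz e).eq t ht, (isW21_primitive_edge d e).eq t ht, he,
      intervalIntegral_congr_ae_unit (hd.ae_eq (represents_self d) e) ht]
  refine step e ?_
  induction e using edge_induction with
  | root => rw [h0, primitive_root]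
  | child e he l ih => rw [← hg, primitive_child, step e ih 1 ⟨zero_le_one, le_rfl⟩]

/-- The Poincaré inequality on the tree: the solution of `z' + b z = G` that vanishes at the root
is controlled by `G`. -/
theorem exists_poincare (P : TimeTree) (M : ℝ) : ∃ K : ℝ, 0 ≤ K ∧
    ∀ (b : P.Edge → ℂ) (z z1 : P.Edge → ℝ → ℂ), (∀ e, ‖b e‖ ≤ M) → (∀ e, IsW21 (z e) (z1 e)) →
    z P.root 0 = 0 → (∀ e he l, z e 1 = z (P.child e he l) 0) →
    Summable (fun e => P.weight e * ∫ t, ‖z1 e t + b e * z e t‖ ^ 2 ∂μ₀₁) →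
    Summable (fun e => P.weight e * ∫ t, ‖z e t‖ ^ 2 ∂μ₀₁) ∧
    ∑' e, P.weight e * ∫ t, ‖z e t‖ ^ 2 ∂μ₀₁ ≤
      K * ∑' e, P.weight e * ∫ t, ‖z1 e t + b e * z e t‖ ^ 2 ∂μ₀₁ := by
  set C : ℝ := 2 * Real.exp (2 * M) ^ 2 with hC
  have hC0 : 0 ≤ C := by positivity
  obtain ⟨K, hK0, hK⟩ := exists_tsum_weight_le_real P hC0
  refine ⟨C * (K + 1), by positivity, fun b z z1 hb hz h0 hg hs => ?_⟩
  set G : P.Edge → ℝ := fun e => ∫ t, ‖z1 e t + b e * z e t‖ ^ 2 ∂μ₀₁ with hG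
  have key : ∀ e, ∀ t ∈ Set.Icc (0 : ℝ) 1, ‖z e t‖ ^ 2 ≤ C * (‖z e 0‖ ^ 2 + G e) :=
    fun e t ht => (hz e).norm_sq_le (hb e) ht
  obtain ⟨s1, s2⟩ := hK (fun e => ‖z e 0‖ ^ 2) G (fun e => by positivity)
    (fun e => integral_nonneg fun t => by positivity) (by simp [h0])
    (fun e he l => by
      rw [← hg]
      exact key e 1 ⟨zero_le_one, le_rfl⟩) hs
  have hint : ∀ e, ∫ t, ‖z e t‖ ^ 2 ∂μ₀₁ ≤ C * (‖z e 0‖ ^ 2 + G e) := by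
    intro e
    have := setIntegral_mono_on ((hz e).memLp_self.integrable_norm_pow (p := 2) (by norm_num))
      (integrable_const (C * (‖z e 0‖ ^ 2 + G e))) measurableSet_Icc (key e)
    simpa using this
  have hle : ∀ e, P.weight e * ∫ t, ‖z e t‖ ^ 2 ∂μ₀₁ ≤
      C * (P.weight e * ‖z e 0‖ ^ 2 + P.weight e * G e) := fun e => by
    have := mul_le_mul_of_nonneg_left (hint e) (weight_pos e).le
    linarith
  have hsum := (s1.add hs).mul_left C
  have hsz : Summable (fun e => P.weight e * ∫ t, ‖z e t‖ ^ 2 ∂μ₀₁) :=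
    Summable.of_nonneg_of_le (fun e => mul_nonneg (weight_pos e).le
      (integral_nonneg fun t => by positivity)) hle hsum
  refine ⟨hsz, (hsz.tsum_le_tsum hle hsum).trans ?_⟩
  rw [tsum_mul_left, s1.tsum_add hs, mul_assoc C]
  refine mul_le_mul_of_nonneg_left ?_ hC0
  linarith

/-- The Poincaré inequality with `b = 0` puts the primitives in `L_{2,α}`, with a bound. -/
theorem exists_primitive_operator (P : TimeTree) :
    ∃ S : P.L2α →L[ℂ] P.L2α, ∀ d, P.Represents (S d) (primitive d) := by
  obtain ⟨K, hK0, hK⟩ := exists_poincare P 0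
  have h : ∀ d : P.L2α, ∃ f : P.L2α, P.Represents f (primitive d) ∧ ‖f‖ ≤ √K * ‖d‖ := by
    intro d
    have hd := (represents_self d).hasSum_norm_sq
    have hp := hK (fun _ => 0) (primitive d) (fun e => d e) (by simp) (isW21_primitive_edge d)
      (primitive_root d) (fun e he l => (primitive_child d e he l).symm)
      (by simpa only [zero_mul, add_zero] using hd.summable)
    obtain ⟨f, hf⟩ := exists_represents (fun e => (isW21_primitive_edge d e).memLp_self) hp.1
    refine ⟨f, hf, ?_⟩
    have h2 := hp.2
    simp only [zero_mul, add_zero] at h2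
    rw [hf.hasSum_norm_sq.tsum_eq, hd.tsum_eq] at h2
    refine (sq_le_sq₀ (norm_nonneg _) (by positivity)).1 ?_
    rwa [mul_pow, Real.sq_sqrt hK0]
  choose S hS hSn using h
  refine ⟨LinearMap.mkContinuous
    { toFun := S
      map_add' := fun d d' => ?_
      map_smul' := fun c d => ?_ } (√K) hSn, hS⟩
  · refine (hS (d + d')).ext ((hS d).add (hS d')) fun e => ?_
    refine (ae_restrict_iff' measurableSet_Icc).2 (Filter.Eventually.of_forall fun t ht => ?_)
    refine (primitive_unique (z := primitive d + primitive d') (fun e =>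
      (isW21_primitive_edge d e).add (isW21_primitive_edge d' e))
      ((represents_self d).add (represents_self d')) ?_ ?_ e t ht).symm
    · simp [primitive_root]
    · simp [primitive_child]
  · refine (hS (c • d)).ext ((hS d).smul c) fun e => ?_
    refine (ae_restrict_iff' measurableSet_Icc).2 (Filter.Eventually.of_forall fun t ht => ?_)
    refine (primitive_unique (z := c • primitive d) (fun e =>
      (isW21_primitive_edge d e).smul c) ((represents_self d).smul c) ?_ ?_ e t ht).symm
    · simp [primitive_root]
    · simp [primitive_child]

/-- The bounded operator that takes a derivative to its primitive. -/
def primitiveOp (P : TimeTree) : P.L2α →L[ℂ] P.L2α := (exists_primitive_operator P).choose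

theorem represents_primitiveOp (d : P.L2α) : P.Represents (P.primitiveOp d) (primitive d) :=
  (exists_primitive_operator P).choose_spec d

end Primitive

/-! ### The quadratic form and Green's formula -/

section Form

variable {P : TimeTree}

/-- Multiplication by the coefficients `b_e`. -/
def coeffOp (P : TimeTree) : P.L2α →L[ℂ] P.L2α :=
  mulCoeff P.coeff (coeff_bdd P).choose_spec.2

/-- Multiplication by the conjugates of the coefficients `b_e`. -/
def conjCoeffOp (P : TimeTree) : P.L2α →L[ℂ] P.L2α :=
  mulCoeff (fun e => starRingEnd ℂ (P.coeff e)) (M := (coeff_bdd P).choose) fun e => by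
    rw [RCLike.norm_conj]
    exact (coeff_bdd P).choose_spec.2 e

theorem Represents.coeffOp {f : P.L2α} {y : P.Edge → ℝ → ℂ} (h : P.Represents f y) :
    P.Represents (P.coeffOp f) fun e t => P.coeff e * y e t :=
  h.mulCoeff _ _

theorem Represents.conjCoeffOp {f : P.L2α} {y : P.Edge → ℝ → ℂ} (h : P.Represents f y) :
    P.Represents (P.conjCoeffOp f) fun e t => starRingEnd ℂ (P.coeff e) * y e t :=
  h.mulCoeff _ _

theorem inner_coeffOp_left (f g : P.L2α) :
    inner ℂ (P.coeffOp f) g = inner ℂ f (P.conjCoeffOp g) := by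
  have hf := represents_self f
  have hg := represents_self g
  refine (hf.coeffOp.hasSum_inner hg).unique ((hf.hasSum_inner hg.conjCoeffOp).congr_fun
    fun e => ?_)
  congr 2
  ext t
  rw [map_mul]
  ring

/-- The flux `y' + b y` of the primitive `y` of `d`, in terms of `d`. -/
def fluxOp (P : TimeTree) : P.L2α →L[ℂ] P.L2α :=
  ContinuousLinearMap.id ℂ P.L2α + P.coeffOp.comp P.primitiveOp

theorem fluxOp_apply (d : P.L2α) : P.fluxOp d = d + P.coeffOp (P.primitiveOp d) := rfl

theorem inner_fluxOp_left (k u : P.L2α) :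
    inner ℂ (P.fluxOp k) u = inner ℂ k u + inner ℂ (P.primitiveOp k) (P.conjCoeffOp u) := by
  rw [fluxOp_apply, inner_add_left, inner_coeffOp_left]

/-- Both a tuple and its derivative are controlled by the flux. -/
theorem exists_norm_le_fluxOp (P : TimeTree) : ∃ K : ℝ, 0 < K ∧ ∀ d : P.L2α,
    ‖P.primitiveOp d‖ ≤ K * ‖P.fluxOp d‖ ∧ ‖d‖ ≤ K * ‖P.fluxOp d‖ := by
  obtain ⟨M, hM0, hM⟩ := coeff_bdd P
  obtain ⟨K, hK0, hK⟩ := exists_poincare P M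
  set B : ℝ := ‖(coeff_bdd P).choose‖
  have hB : 0 ≤ B := norm_nonneg _
  have hS : ∀ d : P.L2α, ‖P.primitiveOp d‖ ≤ √K * ‖P.fluxOp d‖ := by
    intro d
    have hf : P.Represents (P.fluxOp d) fun e t => d e t + P.coeff e * primitive d e t :=
      (represents_self d).add (represents_primitiveOp d).coeffOp
    have h := (hK P.coeff (primitive d) (fun e => d e) hM (isW21_primitive_edge d)
      (primitive_root d) (fun e he l => (primitive_child d e he l).symm)
      hf.hasSum_norm_sq.summable).2
    rw [(represents_primitiveOp d).hasSum_norm_sq.tsum_eq, hf.hasSum_norm_sq.tsum_eq] at h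
    refine (sq_le_sq₀ (norm_nonneg _) (by positivity)).1 ?_
    rwa [mul_pow, Real.sq_sqrt hK0]
  refine ⟨1 + √K + B * √K, by positivity, fun d => ⟨(hS d).trans ?_, ?_⟩⟩
  · refine mul_le_mul_of_nonneg_right ?_ (norm_nonneg _)
    have : 0 ≤ B * √K := by positivity
    linarith
  · have h1 : d = P.fluxOp d - P.coeffOp (P.primitiveOp d) := by
      rw [fluxOp_apply, add_sub_cancel_right]
    have h2 : ‖d‖ ≤ ‖P.fluxOp d‖ + B * ‖P.primitiveOp d‖ := by
      conv_lhs => rw [h1]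
      exact (norm_sub_le _ _).trans (by gcongr; exact norm_mulCoeff_le _ _ _)
    have h3 := mul_le_mul_of_nonneg_left (hS d) hB
    have h4 : 0 ≤ √K * ‖P.fluxOp d‖ := by positivity
    nlinarith

/-- The derivatives of the tuples in the form domain: their primitives vanish at all boundary
vertices. -/
def formDomain (P : TimeTree) : Submodule ℂ P.L2α :=
  ⨅ e : {e : P.Edge // P.IsLeaf e}, (startValue e.1.1 e.1.2 + edgeIntegral e.1).ker

theorem mem_formDomain {d : P.L2α} :
    d ∈ P.formDomain ↔ ∀ e, P.IsLeaf e → primitive d e 1 = 0 := by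
  simp only [formDomain, Submodule.mem_iInf, Subtype.forall, primitive_one]
  rfl

theorem isClosed_formDomain (P : TimeTree) : IsClosed (P.formDomain : Set P.L2α) := by
  rw [formDomain, Submodule.coe_iInf]
  exact isClosed_iInter fun e => ContinuousLinearMap.isClosed_ker _

theorem summable_trace {f f1 : P.L2α} {y y1 : P.Edge → ℝ → ℂ} (hf : P.Represents f y)
    (hf1 : P.Represents f1 y1) (h : ∀ e, IsW21 (y e) (y1 e)) {t : ℝ}
    (ht : t ∈ Set.Icc (0 : ℝ) 1) : Summable fun e => P.weight e * ‖y e t‖ ^ 2 := by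
  refine Summable.of_nonneg_of_le (fun e => mul_nonneg (weight_pos e).le (by positivity))
    (fun e => ?_) ((hf.hasSum_norm_sq.summable.add hf1.hasSum_norm_sq.summable).mul_left 2)
  have := mul_le_mul_of_nonneg_left ((h e).trace_sq_le ht) (weight_pos e).le
  linarith

/-- Green's formula for a flux `F` with `-F' + conj b F = h` and a test tuple, the primitive of
`k`. -/
theorem hasSum_green {u h : P.L2α} {F H : P.Edge → ℝ → ℂ} (hF : P.Represents u F)
    (hH : P.Represents h H)
    (hW : ∀ e, IsW21 (F e) fun t => starRingEnd ℂ (P.coeff e) * F e t - H e t) (k : P.L2α) :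
    HasSum (fun e => (P.weight e : ℂ) * (F e 1 * starRingEnd ℂ (primitive k e 1) -
      F e 0 * starRingEnd ℂ (primitive k e 0)))
      (inner ℂ (P.fluxOp k) u - inner ℂ (P.primitiveOp k) h) := by
  have hr : P.Represents (P.conjCoeffOp u + (-1 : ℂ) • h)
      fun e t => starRingEnd ℂ (P.coeff e) * F e t - H e t := by
    refine (hF.conjCoeffOp.add (hH.smul (-1))).congr fun e => Filter.Eventually.of_forall fun t => ?_
    simp [sub_eq_add_neg]
  have h1 := ((represents_self k).hasSum_inner hF).add
    ((represents_primitiveOp k).hasSum_inner hr)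
  have hval : inner ℂ k u + inner ℂ (P.primitiveOp k) (P.conjCoeffOp u + (-1 : ℂ) • h) =
      inner ℂ (P.fluxOp k) u - inner ℂ (P.primitiveOp k) h := by
    rw [inner_fluxOp_left, inner_add_right, inner_smul_right]
    ring
  rw [hval] at h1
  refine h1.congr_fun fun e => ?_
  have hz := isW21_primitive_edge k e
  rw [← (hW e).integral_by_parts hz, ← mul_add]
  congr 1
  refine integral_add ?_ ?_
  · exact (hW e).memLp_self.integrable_mul hz.memLp.star
  · exact (hW e).memLp.integrable_mul hz.memLp_self.star

theorem summable_p_mul_θ (P : TimeTree) : Summable fun l => (P.p l : ℂ) * P.θ l := by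
  obtain ⟨M, hM⟩ := P.θ_bdd
  refine Summable.of_norm_bounded (P.p_sum.summable.mul_right M) fun l => ?_
  rw [norm_mul, Complex.norm_real, Real.norm_of_nonneg (P.p_pos l).le]
  exact mul_le_mul_of_nonneg_left (hM l) (P.p_pos l).le

/-- The Kirchhoff condition says that the flux `y' + b y` is conserved at the internal vertices. -/
theorem kirchhoff_iff {y y1 F : P.Edge → ℝ → ℂ}
    (hg : ∀ (e : P.Edge) (he : P.IsInner e) (l : ℕ), y e 1 = y (P.child e he l) 0)
    (h0 : ∀ e, F e 0 = y1 e 0 + P.coeff e * y e 0) (h1 : ∀ e, F e 1 = y1 e 1 + P.coeff e * y e 1)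
    (e : P.Edge) (he : P.IsInner e) :
    HasSum (fun l => (P.p l : ℂ) * F (P.child e he l) 0) (F e 1) ↔
    HasSum (fun l => (P.p l : ℂ) * y1 (P.child e he l) 0)
      (y1 e 1 + P.kirchhoffCoeff e * y e 1) := by
  have hθ := (summable_p_mul_θ P).hasSum.mul_right (y e 1)
  have hterm : ∀ l, (P.p l : ℂ) * F (P.child e he l) 0 =
      (P.p l : ℂ) * y1 (P.child e he l) 0 + (P.p l : ℂ) * P.θ l * y e 1 := by
    intro l
    have hc : P.coeff (P.child e he l) = P.θ l := rfl
    rw [h0, ← hg, hc]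
    ring
  have hval : y1 e 1 + P.kirchhoffCoeff e * y e 1 =
      F e 1 - (∑' l, (P.p l : ℂ) * P.θ l) * y e 1 := by
    rw [h1, kirchhoffCoeff]
    ring
  rw [hval]
  constructor
  · intro h
    exact (h.sub hθ).congr_fun fun l => by rw [hterm]; ring
  · intro h
    have h2 := h.add hθ
    rw [sub_add_cancel] at h2
    exact h2.congr_fun hterm

/-- The operator in its variational form. -/
theorem Rel.exists_weak {f h : P.L2α} (a : P.Rel f h) : ∃ d ∈ P.formDomain, P.primitiveOp d = f ∧
    ∀ k ∈ P.formDomain, inner ℂ (P.fluxOp k) (P.fluxOp d) = inner ℂ (P.primitiveOp k) h := by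
  obtain ⟨y, y1, y2, hy, hf, hh⟩ := a
  obtain ⟨d, hd⟩ : ∃ d, P.Represents d y1 := by
    refine exists_represents (fun e => (hy.first e).memLp) ?_
    refine Summable.of_nonneg_of_le (fun e => mul_nonneg (weight_pos e).le
      (integral_nonneg fun t => by positivity)) (fun e => ?_) hy.summable
    refine mul_le_mul_of_nonneg_left ?_ (weight_pos e).le
    have p0 : 0 ≤ ∫ t in Set.Icc (0 : ℝ) 1, ‖y e t‖ ^ 2 := by positivity
    have p2 : 0 ≤ ∫ t in Set.Icc (0 : ℝ) 1, ‖y2 e t‖ ^ 2 := by positivity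
    linarith
  have hyd : ∀ e, ∀ t ∈ Set.Icc (0 : ℝ) 1, y e t = primitive d e t :=
    primitive_unique hy.first hd hy.initial hy.gluing
  have h1I : (1 : ℝ) ∈ Set.Icc (0 : ℝ) 1 := ⟨zero_le_one, le_rfl⟩
  have h0I : (0 : ℝ) ∈ Set.Icc (0 : ℝ) 1 := ⟨le_rfl, zero_le_one⟩
  have hSd : P.primitiveOp d = f := (represents_primitiveOp d).ext hf fun e =>
    (ae_restrict_iff' measurableSet_Icc).2 (Filter.Eventually.of_forall fun t ht => (hyd e t ht).symm)
  refine ⟨d, mem_formDomain.2 fun e he => by rw [← hyd e 1 h1I, hy.terminal e he], hSd,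
    fun k hk => ?_⟩
  set F : P.Edge → ℝ → ℂ := fun e t => y1 e t + P.coeff e * y e t with hFd
  set H : P.Edge → ℝ → ℂ := fun e => diffExpr (P.coeff e) (y e) (y1 e) (y2 e) with hHd
  have hF : P.Represents (P.fluxOp d) F := by
    rw [fluxOp_apply, hSd]
    exact hd.add hf.coeffOp
  have hW : ∀ e, IsW21 (F e) fun t => starRingEnd ℂ (P.coeff e) * F e t - H e t := by
    intro e
    refine ((hy.second e).add ((hy.first e).smul (P.coeff e))).congr (fun t _ => rfl)
      (Filter.Eventually.of_forall fun t => ?_)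
    have e1 : (((‖P.coeff e‖ ^ 2 : ℝ)) : ℂ) = starRingEnd ℂ (P.coeff e) * P.coeff e := by
      rw [Complex.conj_mul']; push_cast; rfl
    have e2 : 2 * Complex.I * ((P.coeff e).im : ℂ) = P.coeff e - starRingEnd ℂ (P.coeff e) := by
      rw [Complex.sub_conj]; push_cast; ring
    simp only [hFd, hHd, diffExpr, e1, e2, Pi.add_apply, Pi.smul_apply, smul_eq_mul]
    ring
  have green := hasSum_green hF hh hW k
  -- The derivative of the flux is in `L_{2,α}`, which makes its boundary values square summable.
  have hr : ∃ r, P.Represents r fun e t => starRingEnd ℂ (P.coeff e) * F e t - H e t :=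
    ⟨_, (hF.conjCoeffOp.add (hh.smul (-1))).congr fun e => Filter.Eventually.of_forall fun t => by
      simp [sub_eq_add_neg, hHd]⟩
  obtain ⟨r, hr⟩ := hr
  have tF := fun t (ht : t ∈ Set.Icc (0 : ℝ) 1) => summable_trace hF hr hW ht
  have tz := fun t (ht : t ∈ Set.Icc (0 : ℝ) 1) =>
    summable_trace (represents_primitiveOp k) (represents_self k) (isW21_primitive_edge k) ht
  have hzero := tsum_boundary_eq_zero (F0 := fun e => F e 0) (F1 := fun e => F e 1)
    (ζ0 := fun e => starRingEnd ℂ (primitive k e 0))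
    (ζ1 := fun e => starRingEnd ℂ (primitive k e 1)) (tF 0 h0I) (tF 1 h1I)
    (by simpa only [RCLike.norm_conj] using tz 0 h0I)
    (by simpa only [RCLike.norm_conj] using tz 1 h1I)
    (fun e he => (kirchhoff_iff hy.gluing (fun _ => rfl) (fun _ => rfl) e he).2
      (hy.kirchhoff e he))
    (fun e he l => by rw [primitive_child]) (by rw [primitive_root, map_zero])
    (fun e he => by rw [mem_formDomain.1 hk e he, map_zero])
  rw [green.tsum_eq] at hzero
  exact sub_eq_zero.1 hzero

end Form

/-! ### Surjectivity: weak solutions and their regularity -/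

section Surjective

variable {P : TimeTree}

theorem exists_weak_solution (h : P.L2α) : ∃ d ∈ P.formDomain, ∀ k ∈ P.formDomain,
    inner ℂ (P.fluxOp k) (P.fluxOp d) = inner ℂ (P.primitiveOp k) h := by
  have : CompleteSpace P.formDomain := (isClosed_formDomain P).completeSpace_coe
  obtain ⟨K, hK0, hK⟩ := exists_norm_le_fluxOp P
  set R : P.formDomain →L[ℂ] P.L2α := P.fluxOp.comp P.formDomain.subtypeL
  set S : P.formDomain →L[ℂ] P.L2α := P.primitiveOp.comp P.formDomain.subtypeL
  -- The form is coercive because `d` is controlled by its flux.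
  set A : P.formDomain →L[ℂ] P.formDomain := R.adjoint.comp R with hA
  have hc : 0 < Real.toNNReal ((K ^ 2)⁻¹) := by
    rw [Real.toNNReal_pos]; positivity
  have hunit : IsUnit A := by
    refine ContinuousLinearMap.isUnit_of_forall_le_norm_inner_map A hc fun x => ?_
    have h1 : inner ℂ (A x) x = inner ℂ (R x) (R x) := R.adjoint_inner_left _ _
    rw [h1, inner_self_eq_norm_sq_to_K, Real.coe_toNNReal _ (by positivity)]
    simp only [Complex.coe_algebraMap, norm_pow, Complex.norm_real, norm_norm]
    rw [mul_inv_le_iff₀ (by positivity), ← mul_pow, mul_comm]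
    exact pow_le_pow_left₀ (norm_nonneg _) (hK x).2 2
  obtain ⟨d, hd⟩ := (ContinuousLinearMap.isUnit_iff_bijective.1 hunit).2 (S.adjoint h)
  refine ⟨d, d.2, fun k hk => ?_⟩
  have h1 : inner ℂ (⟨k, hk⟩ : P.formDomain) (A d) = inner ℂ (R ⟨k, hk⟩) (R d) :=
    R.adjoint_inner_right _ _
  have h2 : inner ℂ (⟨k, hk⟩ : P.formDomain) (S.adjoint h) = inner ℂ (S ⟨k, hk⟩) h :=
    S.adjoint_inner_right _ _
  rw [hd, h2] at h1
  exact h1.symm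

/-- A glued tuple that vanishes at all boundary vertices and whose derivative has finite norm is
the primitive of an element of the form domain. -/
theorem exists_mem_formDomain {z z1 : P.Edge → ℝ → ℂ} (hz : ∀ e, IsW21 (z e) (z1 e))
    (hs : Summable fun e => P.weight e * ∫ t, ‖z1 e t‖ ^ 2 ∂μ₀₁) (h0 : z P.root 0 = 0)
    (hg : ∀ e he l, z e 1 = z (P.child e he l) 0) (h1 : ∀ e, P.IsLeaf e → z e 1 = 0) :
    ∃ k ∈ P.formDomain, P.Represents k z1 ∧ P.Represents (P.primitiveOp k) z ∧
      ∀ e, ∀ t ∈ Set.Icc (0 : ℝ) 1, primitive k e t = z e t := by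
  obtain ⟨k, hk⟩ := exists_represents (fun e => (hz e).memLp) hs
  have hu := primitive_unique hz hk h0 hg
  refine ⟨k, mem_formDomain.2 fun e he => ?_, hk,
    (represents_primitiveOp k).congr fun e => ?_, fun e t ht => (hu e t ht).symm⟩
  · rw [← hu e 1 ⟨zero_le_one, le_rfl⟩, h1 e he]
  · exact (ae_restrict_iff' measurableSet_Icc).2 (Filter.Eventually.of_forall (hu e))

/-- The flux of a weak solution is absolutely continuous on each edge: the test tuples supported
on one edge give its distributional derivative. -/
theorem exists_flux {d h : P.L2α} (hw : ∀ k ∈ P.formDomain,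
    inner ℂ (P.fluxOp k) (P.fluxOp d) = inner ℂ (P.primitiveOp k) h) :
    ∃ F : P.Edge → ℝ → ℂ, P.Represents (P.fluxOp d) F ∧
      ∀ e, IsW21 (F e) fun t => starRingEnd ℂ (P.coeff e) * F e t - h e t := by
  classical
  set u := P.fluxOp d with hud
  have hu := represents_self u
  have hh := represents_self h
  have key : ∀ e, ∃ v, IsW21 v (fun t => starRingEnd ℂ (P.coeff e) * u e t - h e t) ∧
      v =ᵐ[μ₀₁] u e := by
    intro e
    have hr : P.Represents (P.conjCoeffOp u + (-1 : ℂ) • h)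
        fun e t => starRingEnd ℂ (P.coeff e) * u e t - h e t := by
      refine (hu.conjCoeffOp.add (hh.smul (-1))).congr fun e =>
        Filter.Eventually.of_forall fun t => ?_
      simp [sub_eq_add_neg]
    refine exists_isW21_of_weak (hu.memLp e) (hr.memLp e) fun z z1 hz hz0 hz1 => ?_
    have hZ : ∀ e', IsW21 ((Pi.single e z : P.Edge → ℝ → ℂ) e')
        ((Pi.single e z1 : P.Edge → ℝ → ℂ) e') := by
      intro e'
      rcases eq_or_ne e' e with rfl | hne
      · simpa using hz
      · rw [Pi.single_eq_of_ne hne, Pi.single_eq_of_ne hne]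
        exact ⟨MemLp.zero, by simp⟩
    have hZ0 : ∀ e', (Pi.single e z : P.Edge → ℝ → ℂ) e' 0 = 0 := by
      intro e'
      rcases eq_or_ne e' e with rfl | hne
      · simpa using hz0
      · simp [Pi.single_eq_of_ne hne]
    have hZ1 : ∀ e', (Pi.single e z : P.Edge → ℝ → ℂ) e' 1 = 0 := by
      intro e'
      rcases eq_or_ne e' e with rfl | hne
      · simpa using hz1
      · simp [Pi.single_eq_of_ne hne]
    obtain ⟨k, hk, hk1, hSk, -⟩ := exists_mem_formDomain hZ
      (summable_of_ne_finset_zero (s := {e}) fun e' he' => by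
        rw [Finset.mem_singleton] at he'
        simp [Pi.single_eq_of_ne he'])
      (hZ0 _) (fun e' _ _ => by rw [hZ1, hZ0]) fun e' _ => hZ1 e'
    have h1 := (hk1.hasSum_inner hu).add (hSk.hasSum_inner hr)
    have h2 : inner ℂ k u + inner ℂ (P.primitiveOp k) (P.conjCoeffOp u + (-1 : ℂ) • h) = 0 := by
      have := hw k hk
      rw [inner_fluxOp_left] at this
      rw [inner_add_right, inner_smul_right, ← this]
      ring
    rw [h2] at h1
    have h3 := h1.unique (hasSum_single e fun e' he' => by simp [Pi.single_eq_of_ne he'])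
    simp only [Pi.single_eq_same] at h3
    rw [← mul_add] at h3
    have hw0 : (P.weight e : ℂ) ≠ 0 := by exact_mod_cast (weight_pos e).ne'
    refine (integral_add ?_ ?_).trans ((mul_eq_zero.1 h3.symm).resolve_left hw0)
    · exact (hu.memLp e).integrable_mul hz.memLp.star
    · exact (hr.memLp e).integrable_mul hz.memLp_self.star
  choose F hF hFu using key
  refine ⟨F, hu.congr hFu, fun e => (hF e).congr (fun _ _ => rfl) ?_⟩
  filter_upwards [hFu e] with t ht
  rw [ht]

theorem child_injective (e : P.Edge) (he : P.IsInner e) : Function.Injective (P.child e he) := by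
  intro l l' h
  have := congrArg Subtype.val h
  simp only [child, List.cons.injEq] at this
  exact this.1

theorem child_ne (e : P.Edge) (he : P.IsInner e) (l : ℕ) : P.child e he l ≠ e := by
  intro h
  have := congrArg (fun x => x.1.length) h
  simp [child] at this

theorem child_ne_root (e : P.Edge) (he : P.IsInner e) (l : ℕ) : P.root ≠ P.child e he l := by
  intro h
  have := congrArg Subtype.val h
  simp [child, root] at this

theorem child_mem_range_iff {e e' : P.Edge} (he : P.IsInner e) (he' : P.IsInner e') (l : ℕ) :
    P.child e' he' l ∈ Set.range (P.child e he) ↔ e' = e := by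
  constructor
  · rintro ⟨l', h⟩
    have := congrArg Subtype.val h
    simp only [child, List.cons.injEq] at this
    exact Subtype.ext this.2.symm
  · rintro rfl
    exact ⟨l, rfl⟩

/-- The flux of a weak solution is conserved at each internal vertex: the test tuple is supported
on the edges at the vertex, where it rises to one along `e` and falls to zero along the children
of `e`. -/
theorem hasSum_flux {d h : P.L2α} (hw : ∀ k ∈ P.formDomain,
    inner ℂ (P.fluxOp k) (P.fluxOp d) = inner ℂ (P.primitiveOp k) h)
    {F : P.Edge → ℝ → ℂ} (hF : P.Represents (P.fluxOp d) F)
    (hW : ∀ e, IsW21 (F e) fun t => starRingEnd ℂ (P.coeff e) * F e t - h e t)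
    (e : P.Edge) (he : P.IsInner e) :
    HasSum (fun l => (P.p l : ℂ) * F (P.child e he l) 0) (F e 1) := by
  classical
  set s := Set.range (P.child e he) with hs
  have hes : e ∉ s := by
    rintro ⟨l, hl⟩
    exact child_ne e he l hl
  set z : P.Edge → ℝ → ℂ := fun e' t =>
    if e' = e then (t : ℂ) else if e' ∈ s then 1 - (t : ℂ) else 0 with hz
  set z1 : P.Edge → ℝ → ℂ := fun e' _ =>
    if e' = e then 1 else if e' ∈ s then -1 else 0 with hz1
  have hzW : ∀ e', IsW21 (z e') (z1 e') := by
    intro e'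
    refine ⟨memLp_const _, fun t _ => ?_⟩
    simp only [hz, hz1, intervalIntegral.integral_const]
    split_ifs <;> simp [sub_eq_add_neg]
  have hsum : Summable fun e' => P.weight e' * ∫ t, ‖z1 e' t‖ ^ 2 ∂μ₀₁ := by
    have a1 : Summable fun e' => if e' = e then P.weight e else 0 :=
      (hasSum_ite_eq e (P.weight e)).summable
    have a2 : Summable fun e' => if e' ∈ s then P.weight e' else 0 := by
      refine ((child_injective e he).summable_iff fun e' he' => if_neg he').1 ?_
      refine (P.p_sum.summable.mul_right (P.weight e)).congr fun l => ?_
      rw [Function.comp_apply, if_pos (Set.mem_range_self l), weight_child]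
    refine (a1.add a2).congr fun e' => ?_
    by_cases h1 : e' = e
    · subst h1
      simp [hz1, hes]
    · by_cases h2 : e' ∈ s <;> simp [hz1, h1, h2]
  obtain ⟨k, hk, -, -, hkz⟩ := exists_mem_formDomain hzW hsum
    (by
      have : P.root ∉ s := by
        rintro ⟨l, hl⟩
        exact child_ne_root e he l hl.symm
      simp [hz, this])
    (fun e' he' l => by
      have h1 : P.child e' he' l ∈ s ↔ e' = e := child_mem_range_iff he he' l
      by_cases h2 : e' = e
      · subst h2
        simp [hz, child_ne, h1]
      · by_cases h3 : P.child e' he' l = e <;> by_cases h4 : e' ∈ s <;> simp [hz, h1, h2, h3, h4])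
    (fun e' he' => by
      have h1 : e' ≠ e := by
        rintro rfl
        exact (Nat.ne_of_lt he) he'
      by_cases h4 : e' ∈ s <;> simp [hz, h1, h4])
  have green := hasSum_green hF (represents_self h) hW k
  rw [hw k hk, sub_self] at green
  have h0I : (0 : ℝ) ∈ Set.Icc (0 : ℝ) 1 := ⟨le_rfl, zero_le_one⟩
  have h1I : (1 : ℝ) ∈ Set.Icc (0 : ℝ) 1 := ⟨zero_le_one, le_rfl⟩
  simp only [hkz _ _ h0I, hkz _ _ h1I] at green
  -- Without the term of `e` itself, the sum runs over the children of `e`.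
  have hsub := green.sub (hasSum_ite_eq e ((P.weight e : ℂ) * F e 1))
  rw [← (child_injective e he).hasSum_iff] at hsub
  · have h2 := hsub.mul_left (-(P.weight e : ℂ)⁻¹)
    have hw0 : (P.weight e : ℂ) ≠ 0 := by exact_mod_cast (weight_pos e).ne'
    have hval : -(P.weight e : ℂ)⁻¹ * (0 - (P.weight e : ℂ) * F e 1) = F e 1 := by
      field_simp
      ring
    rw [hval] at h2
    refine h2.congr_fun fun l => ?_
    have hls : P.child e he l ∈ s := Set.mem_range_self l
    simp only [Function.comp_apply, hz, if_neg (child_ne e he l), if_pos hls, weight_child]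
    push_cast
    field_simp
    simp
    ring
  · intro e' he'
    by_cases h1 : e' = e
    · subst h1
      simp [hz]
    · have he'' : e' ∉ s := he'
      simp [hz, h1, he'']

theorem exists_rel_right (h : P.L2α) : ∃ f, P.Rel f h := by
  obtain ⟨d, hd, hw⟩ := exists_weak_solution h
  obtain ⟨F, hF, hW⟩ := exists_flux hw
  have hy := represents_primitiveOp d
  set y := primitive d with hyd
  set y1 : P.Edge → ℝ → ℂ := fun e t => F e t - P.coeff e * y e t with hy1d
  have hd1 : P.Represents d y1 := by
    have h1 : P.Represents (P.fluxOp d) fun e t => d e t + P.coeff e * y e t :=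
      (represents_self d).add hy.coeffOp
    refine (represents_self d).congr fun e => ?_
    filter_upwards [hF.ae_eq h1 e] with t ht
    simp only [hy1d, ht]
    ring
  have hyW : ∀ e, IsW21 (y e) (y1 e) := fun e =>
    (isW21_primitive_edge d e).congr (fun _ _ => rfl) (hd1.ae_eq (represents_self d) e)
  set y2 : P.Edge → ℝ → ℂ := fun e t =>
    starRingEnd ℂ (P.coeff e) * F e t - h e t - P.coeff e * y1 e t with hy2d
  have hy1W : ∀ e, IsW21 (y1 e) (y2 e) := fun e =>
    ((hW e).add ((hyW e).smul (-P.coeff e))).congr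
      (fun t _ => by simp [hy1d, sub_eq_add_neg])
      (Filter.Eventually.of_forall fun t => by simp [hy2d, sub_eq_add_neg])
  have hy2 : P.Represents (P.conjCoeffOp (P.fluxOp d) + (-1 : ℂ) • h + (-1 : ℂ) • P.coeffOp d) y2 := by
    refine ((hF.conjCoeffOp.add ((represents_self h).smul (-1))).add
      (hd1.coeffOp.smul (-1))).congr fun e => Filter.Eventually.of_forall fun t => ?_
    simp [hy2d, sub_eq_add_neg]
  have hg : ∀ (e : P.Edge) (he : P.IsInner e) (l : ℕ), y e 1 = y (P.child e he l) 0 :=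
    fun e he l => (primitive_child d e he l).symm
  refine ⟨P.primitiveOp d, y, y1, y2, ⟨⟨hyW, hy1W, ?_⟩, hg, fun e he => ?_, primitive_root d,
    mem_formDomain.1 hd⟩, hy, ?_⟩
  · refine ((hy.hasSum_norm_sq.summable.add hd1.hasSum_norm_sq.summable).add
      hy2.hasSum_norm_sq.summable).congr fun e => ?_
    ring
  · exact (kirchhoff_iff hg (fun e => by simp [hy1d]) (fun e => by simp [hy1d]) e he).1
      (hasSum_flux hw hF hW e he)
  · refine (represents_self h).congr fun e => Filter.Eventually.of_forall fun t => ?_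
    have e1 : (((‖P.coeff e‖ ^ 2 : ℝ)) : ℂ) = starRingEnd ℂ (P.coeff e) * P.coeff e := by
      rw [Complex.conj_mul']; push_cast; rfl
    have e2 : 2 * Complex.I * ((P.coeff e).im : ℂ) = P.coeff e - starRingEnd ℂ (P.coeff e) := by
      rw [Complex.sub_conj]; push_cast; ring
    simp only [diffExpr, e1, e2, hy2d, hy1d]
    ring

end Surjective

end TimeTree

/-! ### Self-adjointness and positivity -/

/-- A symmetric operator whose range is the whole space is densely defined and self-adjoint. -/
theorem LinearPMap.dense_and_isSelfAdjoint_of_surjective {𝕜 E : Type*} [RCLike 𝕜]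
    [NormedAddCommGroup E] [InnerProductSpace 𝕜 E] [CompleteSpace E] {A : E →ₗ.[𝕜] E}
    (hA : A.IsFormalAdjoint A) (hs : ∀ h, ∃ f : A.domain, A f = h) :
    Dense (A.domain : Set E) ∧ IsSelfAdjoint A := by
  have hd : Dense (A.domain : Set E) := by
    rw [Submodule.dense_iff_topologicalClosure_eq_top, Submodule.topologicalClosure_eq_top_iff,
      Submodule.eq_bot_iff]
    intro u hu
    obtain ⟨w, rfl⟩ := hs u
    have hw : (w : E) = 0 := by
      obtain ⟨v, hv⟩ := hs w
      have h1 : inner 𝕜 (w : E) (w : E) = 0 := by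
        nth_rewrite 1 [← hv]
        rw [hA v w]
        exact hu v v.2
      exact inner_self_eq_zero.1 h1
    rw [(Subtype.ext hw : w = 0), LinearPMap.map_zero]
  refine ⟨hd, LinearPMap.isSelfAdjoint_def.2 (le_antisymm ?_ (hA.le_adjoint hd))⟩
  have hdom : ∀ z : A.adjoint.domain, ∃ w : A.domain, (w : E) = z ∧ A w = A.adjoint z := by
    intro z
    obtain ⟨w, hw⟩ := hs (A.adjoint z)
    refine ⟨w, ?_, hw⟩
    obtain ⟨v, hv⟩ := hs ((w : E) - z)
    have h1 : inner 𝕜 (A v) ((w : E) - z) = 0 := by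
      rw [inner_sub_right, hA v w, (LinearPMap.adjoint_isFormalAdjoint hd).symm v z, hw, sub_self]
    rw [hv] at h1
    exact sub_eq_zero.1 (inner_self_eq_zero.1 h1)
  refine ⟨fun z hz => ?_, fun x y hxy => ?_⟩
  · obtain ⟨w, hw, -⟩ := hdom ⟨z, hz⟩
    exact (show (w : E) = z from hw) ▸ w.2
  · obtain ⟨w, hw, hw'⟩ := hdom x
    rw [← hw', Subtype.ext (hw.trans hxy)]

namespace TimeTree

variable {P : TimeTree}

theorem isFormalAdjoint_operator (P : TimeTree) : P.operator.IsFormalAdjoint P.operator := by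
  intro g f
  obtain ⟨d, hd, hSd, hwd⟩ := (operator_rel P f).exists_weak
  obtain ⟨k, hk, hSk, hwk⟩ := (operator_rel P g).exists_weak
  rw [← hSd, ← hSk, ← hwd k hk, ← inner_conj_symm, ← hwk d hd, inner_conj_symm]

theorem operator_surjective (h : P.L2α) : ∃ f : P.operator.domain, P.operator f = h := by
  obtain ⟨f, hf⟩ := exists_rel_right h
  have hmem : f ∈ P.operator.domain := by
    obtain ⟨y, y1, y2, hy, hfy, -⟩ := hf
    exact ⟨y, y1, y2, hy, hfy⟩
  exact ⟨⟨f, hmem⟩, (operator_rel P ⟨f, hmem⟩).unique hf⟩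

end TimeTree

/-- The operator is (densely defined and) self-adjoint and positive definite in `L_{2,α}`. -/
theorem theorem2 (P : TimeTree) :
    Dense (P.operator.domain : Set P.L2α) ∧
    IsSelfAdjoint P.operator ∧
    ∃ c : ℝ, 0 < c ∧ ∀ f : P.operator.domain,
      c * ‖(f : P.L2α)‖ ^ 2 ≤ (inner ℂ (P.operator f) (f : P.L2α)).re := by
  obtain ⟨hd, hs⟩ := LinearPMap.dense_and_isSelfAdjoint_of_surjective
    (TimeTree.isFormalAdjoint_operator P) TimeTree.operator_surjective
  obtain ⟨K, hK0, hK⟩ := P.exists_norm_le_fluxOp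
  refine ⟨hd, hs, (K ^ 2)⁻¹, by positivity, fun f => ?_⟩
  obtain ⟨d, hdm, hSd, hw⟩ := (TimeTree.operator_rel P f).exists_weak
  have h1 : (inner ℂ (P.operator f) (f : P.L2α)).re = ‖P.fluxOp d‖ ^ 2 := by
    rw [← inner_conj_symm, ← hSd, ← hw d hdm, inner_self_eq_norm_sq_to_K]
    simp [← Complex.ofReal_pow]
  rw [h1, inv_mul_le_iff₀ (by positivity), ← mul_pow, ← hSd]
  exact pow_le_pow_left₀ (norm_nonneg _) (hK d).1 2

end
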